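/- All digraphs are finite, non-empty oriented graphs (no loops, at most one arc between any two vertices). For a vertex $v$ of a digraph $D$, let $N^+(v)$ be its out-neighborhood and $N^{++}(v)$ the set of vertices at distance exactly $2$ from $v$; $v$ is a *sink* if $N^+(v)=\emptyset$, and $v$ has the *second neighborhood property* (SNP) if $|N^+(v)|\le |N^{++}(v)|$. A *missing edge* $xy$ is an unordered pair of distinct vertices with $(x,y),(y,x)\notin E(D)$; the missing edges form the *missing graph* of $D$, and $D$ is *missing disjoint paths of length at most $2$* if every connected component of its missing graph is a path with at most two edges. A missing edge $e$ *loses to* a missing edge $f$ if one can write $e=xy$, $f=ab$ so that $x\to a$, $b\notin N^+(x)\cup N^{++}(x)$, $y\to b$ and $a\notin N^+(y)\cup N^{++}(y)$. The *dependency digraph* $\Delta(D)$ has the missing edges as vertices, with an arc from $e$ to $f$ whenever $e$ loses to $f$. A *double cycle* in $\Delta(D)$ is given by pairwise disjoint missing paths $a_1b_1c_1,\dots,a_kb_kc_k$ of length $2$ such that, for every $i$ (indices modulo $k$), each of $a_ib_i$, $b_ic_i$ loses to each of $a_{i+1}b_{i+1}$, $b_{i+1}c_{i+1}$; its vertices are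 the edges $a_ib_i, b_ic_i$. **Theorem.** Let $D$ be a digraph missing disjoint paths of length at most $2$. Suppose that $\Delta(D)$ is composed of only directed cycles and double cycles, that is, every (weakly) connected component of $\Delta(D)$ is a directed cycle or consists of the vertices of a double cycle. If $D$ has no sink, then $D$ has at least two vertices with the SNP. -/

import Mathlib

namespace Digraph

variable {V : Type*}

/-- An oriented graph: there is at most one arc between any two vertices and there are no loops
(the case `u = v` of the condition). -/
def IsOrientedGraph (D : Digraph V) : Prop :=
  ∀ u v, D.Adj u v → ¬ D.Adj v u

/-- The out-neighborhood of `v`. -/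
def outNbhd (D : Digraph V) (v : V) : Set V :=
  {u | D.Adj v u}

/-- The second out-neighborhood of `v`: the vertices at distance exactly two from `v`. -/
def secondOutNbhd (D : Digraph V) (v : V) : Set V :=
  {w | w ≠ v ∧ w ∉ D.outNbhd v ∧ ∃ u, D.Adj v u ∧ D.Adj u w}

/-- The second neighborhood property (SNP) of a vertex. -/
def HasSNP (D : Digraph V) (v : V) : Prop :=
  (D.outNbhd v).ncard ≤ (D.secondOutNbhd v).ncard

/-- A sink is a vertex of out-degree zero. -/
def IsSink (D : Digraph V) (v : V) : Prop :=
  D.outNbhd v = ∅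

/-- The missing graph of `D`: its edges are the pairs of distinct vertices joined by no arc.
It is kept on the whole vertex set, so that the vertices incident to no missing edge are its
isolated vertices. -/
def missingGraph (D : Digraph V) : SimpleGraph V where
  Adj x y := x ≠ y ∧ ¬ D.Adj x y ∧ ¬ D.Adj y x
  symm := ⟨fun _ _ h => ⟨h.1.symm, h.2.2, h.2.1⟩⟩
  loopless := ⟨fun _ h => h.1 rfl⟩

/-- `D` is missing disjoint paths of length at most `m`: every connected component of the missing
graph is a path with at most `m` edges (a path with no edge is a vertex incident to no missing
edge). -/
def MissesDisjointPaths (D : Digraph V) (m : ℕ) : Prop :=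
  ∀ c : D.missingGraph.ConnectedComponent,
    ∃ n ≤ m, Nonempty (c.toSimpleGraph ≃g SimpleGraph.pathGraph (n + 1))

/-- The losing relation between two unordered pairs: for some naming `e = xy`, `f = ab`,
`x → a` and `b ∉ N⁺(x) ∪ N⁺⁺(x)`, and `y → b` and `a ∉ N⁺(y) ∪ N⁺⁺(y)`. -/
def Loses (D : Digraph V) (e f : Sym2 V) : Prop :=
  ∃ x y a b, e = s(x, y) ∧ f = s(a, b) ∧
    D.Adj x a ∧ b ∉ D.outNbhd x ∪ D.secondOutNbhd x ∧
    D.Adj y b ∧ a ∉ D.outNbhd y ∪ D.secondOutNbhd y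

/-- The dependency digraph of `D`: its vertices are the missing edges of `D`, its arcs are given
by the losing relation. -/
def dependencyDigraph (D : Digraph V) : Digraph D.missingGraph.edgeSet where
  Adj e f := D.Loses e f

/-- The subdigraph of `H` induced on `S` is a directed cycle (of any length `k ≥ 1`; a cycle of
length two is a pair of opposite arcs, a cycle of length one is a loop). -/
def IsDirectedCycleOn {W : Type*} (H : Digraph W) (S : Set W) : Prop :=
  ∃ k : ℕ, 1 ≤ k ∧ ∃ e : ZMod k → W, Function.Injective e ∧ Set.range e = S ∧
    ∀ i j, H.Adj (e i) (e j) ↔ j = i + 1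

/-- The edges `ab` and `bc` of a path `abc` of length two. -/
def twoPathEdges (p : Fin 3 → V) : Set (Sym2 V) :=
  {s(p 0, p 1), s(p 1, p 2)}

/-- `S` is the vertex set of a double cycle of the dependency digraph: there are pairwise disjoint
missing paths `a₁b₁c₁, …, aₖbₖcₖ` of length two, whose edges are the elements of `S`, such that both
edges of each path lose to both edges of the next one, in cyclic order.
Here `p i` is the path `aᵢbᵢcᵢ`. -/
def IsDoubleCycleOn (D : Digraph V) (S : Set D.missingGraph.edgeSet) : Prop :=
  ∃ k : ℕ, 1 ≤ k ∧ ∃ p : ZMod k → Fin 3 → V,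
    Function.Injective (fun q : ZMod k × Fin 3 => p q.1 q.2) ∧
    (∀ i, twoPathEdges (p i) ⊆ D.missingGraph.edgeSet) ∧
    (∀ e : D.missingGraph.edgeSet, e ∈ S ↔ ∃ i, (e : Sym2 V) ∈ twoPathEdges (p i)) ∧
    ∀ i, ∀ e ∈ twoPathEdges (p i), ∀ f ∈ twoPathEdges (p (i + 1)), D.Loses e f

/-- The dependency digraph is composed of only directed cycles and double cycles: each of its
connected components (that is, of its underlying undirected graph) is a directed cycle or a double
cycle. -/
def ComposedOfCyclesAndDoubleCycles (D : Digraph V) : Prop :=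
  ∀ c : D.dependencyDigraph.toSimpleGraphInclusive.ConnectedComponent,
    D.dependencyDigraph.IsDirectedCycleOn c.supp ∨ D.IsDoubleCycleOn c.supp

end Digraph

/-! A flag is a missing edge with a chosen end. If the flag `(x, y)` loses to `(b, a)`, then,
missing pairs aside, every out-neighbour of `x` is one of `b` and every in-neighbour of `b` is one
of `x` (`Far.out`, `Far.into`). All components of the dependency digraph are strongly connected, so
an arc carried along in this way comes back to where it started. Almost everything about missing
edges follows from that.

The two ends of a missing edge reach each other along flags (`reach_of_missing`), and the classes of
`Reach` are modules (`arc_congr_left`). The quotient is thus a tournament, weighted by class sizes.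
The last class of a median order has the weighted second neighbourhood property, as in the argument
of Havet and Thomassé. Inside a class, a counting argument gives on every missing path a vertex with
the property relative to the class (`classSNP_or`), and the two inequalities add up
(`hasSNP_of_class`). If the last class has a missing edge, it contains two missing paths, hence two
vertices. Otherwise it is a single vertex that is not a sink, and sedimentation of the median order
yields a second class (`exists_second`).

The counting needs the two edges of a missing path to lose to the same edges and to be lost to by
the same edges. Double cycles provide this; `CyclicPath.false` shows that the edges of a path of
length two never lie on directed cycles of the dependency digraph. -/

namespace MedianOrder

/-! ### Median orders of weighted tournaments and their sedimentation -/

variable {Q : Type*} (r : Q → Q → Prop) [DecidableRel r] (w : Q → ℕ)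

/-- The total weight of the out-neighbours of `x` in the list `l`. -/
def outWeight (x : Q) (l : List Q) : ℕ :=
  ((l.filter fun y => decide (r x y)).map w).sum

/-- The total weight of the in-neighbours of `x` in the list `l`. -/
def inWeight (x : Q) (l : List Q) : ℕ :=
  ((l.filter fun y => decide (r y x)).map w).sum

/-- The weight of the forward arcs of the ordering `l`. -/
def forward : List Q → ℕ
  | [] => 0
  | x :: l => w x * outWeight r w x l + forward l

/-- The weight of the arcs from `l₁` to `l₂`. -/
def cross (l₁ l₂ : List Q) : ℕ :=
  (l₁.map fun x => w x * outWeight r w x l₂).sum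

/-- `l` maximizes the weight of the forward arcs among its rearrangements. -/
def IsMedian (l : List Q) : Prop :=
  ∀ l', l'.Perm l → forward r w l' ≤ forward r w l

variable {r w}

theorem outWeight_perm {x : Q} {l l' : List Q} (h : l.Perm l') :
    outWeight r w x l = outWeight r w x l' :=
  ((h.filter _).map _).sum_eq

theorem outWeight_append (x : Q) (l l' : List Q) :
    outWeight r w x (l ++ l') = outWeight r w x l + outWeight r w x l' := by
  simp [outWeight]

theorem inWeight_append (x : Q) (l l' : List Q) :
    inWeight r w x (l ++ l') = inWeight r w x l + inWeight r w x l' := by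
  simp [inWeight]

theorem outWeight_cons (x y : Q) (l : List Q) :
    outWeight r w x (y :: l) = (if r x y then w y else 0) + outWeight r w x l := by
  by_cases h : r x y <;> simp [outWeight, h]

theorem inWeight_cons (x y : Q) (l : List Q) :
    inWeight r w x (y :: l) = (if r y x then w y else 0) + inWeight r w x l := by
  by_cases h : r y x <;> simp [inWeight, h]

theorem outWeight_mono {x z : Q} {l : List Q} (h : ∀ y ∈ l, r x y → r z y) :
    outWeight r w x l ≤ outWeight r w z l := by
  induction l with
  | nil => simp [outWeight]
  | cons y l ih =>
    rw [outWeight_cons, outWeight_cons]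
    refine add_le_add ?_ (ih fun u hu => h u (List.mem_cons_of_mem _ hu))
    have := h y List.mem_cons_self
    split_ifs <;> simp_all

theorem inWeight_mono {x z : Q} {l : List Q} (h : ∀ y ∈ l, r y x → r y z) :
    inWeight r w x l ≤ inWeight r w z l := by
  induction l with
  | nil => simp [inWeight]
  | cons y l ih =>
    rw [inWeight_cons, inWeight_cons]
    refine add_le_add ?_ (ih fun u hu => h u (List.mem_cons_of_mem _ hu))
    have := h y List.mem_cons_self
    split_ifs <;> simp_all

theorem forward_append (l₁ l₂ : List Q) :
    forward r w (l₁ ++ l₂) = forward r w l₁ + forward r w l₂ + cross r w l₁ l₂ := by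
  induction l₁ with
  | nil => simp [forward, cross]
  | cons x l ih =>
    simp only [List.cons_append, forward, ih, outWeight_append, cross, List.map_cons,
      List.sum_cons]
    ring

theorem cross_perm {l₁ l₁' l₂ l₂' : List Q} (h₁ : l₁.Perm l₁') (h₂ : l₂.Perm l₂') :
    cross r w l₁ l₂ = cross r w l₁' l₂' := by
  unfold cross
  simp only [outWeight_perm h₂]
  exact (h₁.map _).sum_eq

theorem cross_singleton (l : List Q) (x : Q) : cross r w l [x] = w x * inWeight r w x l := by
  induction l with
  | nil => simp [cross, inWeight]
  | cons y l ih =>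
    have h : cross r w (y :: l) [x] = w y * outWeight r w y [x] + cross r w l [x] := by
      simp [cross]
    rw [h, ih, inWeight_cons, outWeight_cons]
    split_ifs
    · simp [outWeight]
      ring
    · simp [outWeight]

theorem IsMedian.left {l₁ l₂ : List Q} (h : IsMedian r w (l₁ ++ l₂)) : IsMedian r w l₁ := by
  intro l hl
  have := h (l ++ l₂) (hl.append_right _)
  rw [forward_append, forward_append, cross_perm hl (List.Perm.refl l₂)] at this
  omega

theorem IsMedian.right {l₁ l₂ : List Q} (h : IsMedian r w (l₁ ++ l₂)) : IsMedian r w l₂ := by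
  intro l hl
  have := h (l₁ ++ l) (hl.append_left _)
  rw [forward_append, forward_append, cross_perm (List.Perm.refl l₁) hl] at this
  omega

theorem IsMedian.of_forward_eq {l l' : List Q} (h : IsMedian r w l) (hp : l'.Perm l)
    (he : forward r w l' = forward r w l) : IsMedian r w l' :=
  fun l'' h'' => he ▸ h l'' (h''.trans hp)

theorem IsMedian.forward_eq {l l' : List Q} (h : IsMedian r w l) (h' : IsMedian r w l')
    (hp : l'.Perm l) : forward r w l' = forward r w l :=
  le_antisymm (h _ hp) (h' _ hp.symm)

theorem forward_concat (l : List Q) (x : Q) :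
    forward r w (l ++ [x]) = forward r w l + w x * inWeight r w x l := by
  rw [forward_append, cross_singleton]
  simp [forward, outWeight]

/-- Moving `x` from the last place to the first trades its in-arcs for its out-arcs among the
forward arcs, which cannot be a gain. -/
theorem IsMedian.feed {l : List Q} {x : Q} (hx : 0 < w x) (h : IsMedian r w (l ++ [x])) :
    outWeight r w x l ≤ inWeight r w x l := by
  have := h (x :: l) (List.perm_append_singleton x l).symm
  rw [forward_concat, forward] at this
  exact Nat.le_of_mul_le_mul_left (by omega) hx

theorem IsMedian.rotate {l l' : List Q} {x : Q} (h : IsMedian r w (l ++ [x] ++ l'))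
    (he : outWeight r w x l = inWeight r w x l) : IsMedian r w (x :: l ++ l') := by
  have hp := (List.perm_append_singleton x l).symm
  refine h.of_forward_eq (hp.append_right _) ?_
  rw [forward_append, forward_append (l ++ [x]), cross_perm hp (List.Perm.refl l'),
    forward_concat, forward, he]
  ring

/-- The sedimentation of a median order `P ++ l ++ [x]` none of whose vertices in `P` is bad. -/
theorem IsMedian.sediment (hw : ∀ q, 0 < w q)
    (total : ∀ x y, x ≠ y → r x y ∨ r y x) (x : Q) :
    ∀ l P : List Q, IsMedian r w (P ++ l ++ [x]) → (P ++ l ++ [x]).Nodup →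
      (∀ p ∈ P, r x p ∨ ∃ u ∈ P, r x u ∧ r u p) →
      ∃ B G : List Q, (P ++ l).Perm (B ++ G) ∧ G.Sublist (P ++ l) ∧ (∀ y ∈ B, r y x) ∧
        (∀ p ∈ G, r x p ∨ ∃ u ∈ G, r x u ∧ r u p) ∧
        outWeight r w x G ≤ inWeight r w x G ∧
        (outWeight r w x G = inWeight r w x G → IsMedian r w (B ++ x :: G)) := by
  intro l
  induction l with
  | nil =>
    intro P hm _ hP
    rw [List.append_nil] at hm
    refine ⟨[], P, by simp, by simp, by simp, hP, hm.feed (hw x), fun he => ?_⟩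
    have := IsMedian.rotate (l' := []) (by simpa using hm) he
    simpa using this
  | cons z l ih =>
    intro P hm hnd hP
    by_cases hz : r x z ∨ ∃ u ∈ P, r x u ∧ r u z
    · obtain ⟨B, G, h1, h2, h3⟩ := ih (P ++ [z]) (by simpa using hm) (by simpa using hnd) (by
        intro p hp
        rw [List.mem_append, List.mem_singleton] at hp
        have key : r x p ∨ ∃ u ∈ P, r x u ∧ r u p := by
          rcases hp with hp | rfl
          exacts [hP p hp, hz]
        rcases key with h | ⟨u, hu, h⟩
        · exact Or.inl h
        · exact Or.inr ⟨u, by simp [hu], h⟩)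
      exact ⟨B, G, by simpa using h1, by simpa using h2, h3⟩
    · push Not at hz
      have hzP : z ∉ P := by
        intro h
        rw [List.append_assoc] at hnd
        exact (List.disjoint_of_nodup_append hnd) h (by simp)
      have hxP : x ∉ P := by
        intro h
        rw [List.append_assoc] at hnd
        exact (List.disjoint_of_nodup_append hnd) h (by simp)
      have hzx : z ≠ x := fun h =>
        List.disjoint_of_nodup_append hnd (a := z) (by simp) (by simp [h])
      have hrzx : r z x := (total z x hzx).resolve_right hz.1
      have hm' : IsMedian r w (P ++ [z] ++ (l ++ [x])) := by simpa using hm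
      -- A bad `z` dominates `x` and all out-neighbours of `x` in `P`, so out(x) ≤ out(z) ≤ in(z) ≤
      -- in(x) on `P`, the middle step by `feed`.
      have h1 : outWeight r w x P ≤ outWeight r w z P := outWeight_mono fun y hy hxy =>
        (total z y (fun h => hzP (h ▸ hy))).resolve_right (hz.2 y hy hxy)
      have h2 : outWeight r w z P ≤ inWeight r w z P := hm'.left.feed (hw z)
      have h3 : inWeight r w z P ≤ inWeight r w x P := inWeight_mono fun y hy hyz =>
        (total y x (fun h => hxP (h ▸ hy))).resolve_right fun hxy => hz.2 y hy hxy hyz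
      have hsub : (P ++ l ++ [x]).Sublist (P ++ z :: l ++ [x]) := by simp
      -- If the chain is strict, the surplus on `P` is kept and the process restarts after `z` with
      -- an empty prefix; the clause about equality becomes vacuous. If it is an equality, moving
      -- `z` to the front preserves the median order.
      rcases (h1.trans (h2.trans h3)).lt_or_eq with hlt | heq
      · obtain ⟨B, G, g1, g2, g3, g4, g5, -⟩ := ih [] (by
          simpa using (hm'.right)) (by
          simp only [List.nil_append]
          exact hnd.sublist (by simp)) (by simp)
        simp only [List.nil_append] at g1 g2
        refine ⟨z :: B, P ++ G, ?_, ?_, ?_, ?_, ?_, ?_⟩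
        · refine List.perm_middle.trans (((g1.append_left P).cons z).trans (List.Perm.cons z ?_))
          change (P ++ (B ++ G)).Perm (B ++ (P ++ G))
          rw [← List.append_assoc, ← List.append_assoc]
          exact List.perm_append_comm.append_right G
        · exact (List.Sublist.refl P).append (g2.trans (List.sublist_cons_self z l))
        · intro y hy
          rcases List.mem_cons.1 hy with rfl | hy
          exacts [hrzx, g3 y hy]
        · intro p hp
          rcases List.mem_append.1 hp with hp | hp
          · rcases hP p hp with h | ⟨u, hu, h⟩
            exacts [Or.inl h, Or.inr ⟨u, by simp [hu], h⟩]
          · rcases g4 p hp with h | ⟨u, hu, h⟩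
            exacts [Or.inl h, Or.inr ⟨u, by simp [hu], h⟩]
        · rw [outWeight_append, inWeight_append]; omega
        · rw [outWeight_append, inWeight_append]; omega
      · have hrot : IsMedian r w (z :: (P ++ (l ++ [x]))) := hm'.rotate (by omega)
        have hrest : IsMedian r w (P ++ l ++ [x]) := by
          rw [List.append_assoc]
          exact IsMedian.right (l₁ := [z]) hrot
        obtain ⟨B, G, g1, g2, g3, g4, g5, g6⟩ := ih P hrest (hnd.sublist hsub) hP
        refine ⟨z :: B, G, List.perm_middle.trans (g1.cons z), g2.trans (by simp), ?_, g4, g5, ?_⟩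
        · intro y hy
          rcases List.mem_cons.1 hy with rfl | hy
          exacts [hrzx, g3 y hy]
        · intro he
          have hp : (B ++ x :: G).Perm (P ++ (l ++ [x])) := by
            refine List.perm_middle.trans ?_
            rw [← List.append_assoc]
            exact (g1.symm.cons x).trans (List.perm_append_singleton x _).symm
          rw [← List.append_assoc] at hp hrot
          refine hrot.of_forward_eq (hp.cons z) ?_
          show forward r w (z :: (B ++ x :: G)) = _
          rw [forward, forward, outWeight_perm hp, hrest.forward_eq (g6 he) hp]

theorem exists_isMedian (l : List Q) : ∃ l', l'.Perm l ∧ IsMedian r w l' := by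
  obtain ⟨l', hl', hmax⟩ := Set.exists_max_image {l' | l'.Perm l} (forward r w)
    (by
      classical
      refine (l.permutations.toFinset.finite_toSet).subset fun l' hl' => ?_
      simpa using hl')
    ⟨l, by simp⟩
  exact ⟨l', hl', fun l'' h'' => hmax l'' (h''.trans hl')⟩

theorem length_dropWhile_le {p : Q → Bool} {l l' : List Q} (h : l.Sublist l') :
    (l.dropWhile p).length ≤ (l'.dropWhile p).length := by
  induction h with
  | slnil => simp
  | @cons l₁ l₂ a h ih =>
    rw [List.dropWhile_cons]
    split_ifs
    · exact ih
    · exact ((List.dropWhile_sublist p).trans (h.trans (List.sublist_cons_self a _))).length_le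
  | @cons_cons l₁ l₂ a h ih =>
    rw [List.dropWhile_cons, List.dropWhile_cons]
    split_ifs
    · exact ih
    · simpa using h.length_le

theorem sum_le_of_subset_toFinset [DecidableEq Q] {S : Finset Q} {L : List Q}
    (h : ∀ s ∈ S, s ∈ L) : ∑ s ∈ S, w s ≤ (L.map w).sum := by
  calc ∑ s ∈ S, w s ≤ ∑ s ∈ L.toFinset, w s :=
        Finset.sum_le_sum_of_subset fun s hs => List.mem_toFinset.2 (h s hs)
    _ = (L.dedup.map w).sum := by
        rw [← List.sum_toFinset w L.nodup_dedup]
        congr 1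
        ext
        simp
    _ ≤ (L.map w).sum := ((List.dedup_sublist L).map w).sum_le_sum (by simp)

theorem sum_le_of_toFinset_subset [DecidableEq Q] {S : Finset Q} {L : List Q} (hL : L.Nodup)
    (h : ∀ s ∈ L, s ∈ S) : (L.map w).sum ≤ ∑ s ∈ S, w s := by
  rw [← List.sum_toFinset _ hL]
  exact Finset.sum_le_sum_of_subset fun s hs => h s (List.mem_toFinset.1 hs)

variable (r w) in
/-- The weighted second neighbourhood property of `x`. -/
def HasWeightedSNP (x : Q) : Prop :=
  ∀ S T : Finset Q, (∀ y, y ∈ S ↔ r x y) →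
    (∀ y, y ∈ T ↔ y ≠ x ∧ ¬ r x y ∧ ∃ u, r x u ∧ r u y) → ∑ y ∈ S, w y ≤ ∑ y ∈ T, w y

/-- The last vertex of a median order of a weighted tournament has the weighted second
neighbourhood property. -/
theorem IsMedian.hasWeightedSNP (hw : ∀ q, 0 < w q) (asymm : ∀ x y, r x y → ¬ r y x)
    (total : ∀ x y, x ≠ y → r x y ∨ r y x) {l : List Q} {x : Q} (hm : IsMedian r w (l ++ [x]))
    (hnd : (l ++ [x]).Nodup) (hall : ∀ q, q ∈ l ++ [x]) : HasWeightedSNP r w x := by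
  classical
  intro S T hS hT
  obtain ⟨B, G, h1, h2, h3, h4, h5, -⟩ :=
    hm.sediment hw total x l [] hnd (by simp)
  simp only [List.nil_append] at h1 h2
  have hx : ∀ y ∈ G, y ≠ x := fun y hy h =>
    List.disjoint_of_nodup_append hnd (h2.subset hy) (by simp [h])
  refine (sum_le_of_subset_toFinset (L := G.filter fun y => decide (r x y)) fun y hy => ?_).trans
    (h5.trans (sum_le_of_toFinset_subset ?_ fun y hy => ?_))
  · have hxy := (hS y).1 hy
    have : y ∈ l := by
      have := hall y
      rw [List.mem_append, List.mem_singleton] at this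
      refine this.resolve_right ?_
      rintro rfl
      exact asymm _ _ hxy hxy
    have := h1.subset this
    rw [List.mem_append] at this
    simpa [hxy] using this.resolve_left fun hB => asymm _ _ hxy (h3 y hB)
  · exact (hnd.sublist (h2.trans (List.sublist_append_left _ _))).filter _
  · simp only [List.mem_filter, decide_eq_true_eq] at hy
    obtain ⟨u, -, hu⟩ := (h4 y hy.1).resolve_left (asymm _ _ hy.2)
    exact (hT y).2 ⟨hx y hy.1, asymm _ _ hy.2, u, hu⟩

/-- If the last vertex of a median order of a weighted tournament has weight one and is not a
sink, then some other vertex has the weighted second neighbourhood property. -/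
theorem IsMedian.exists_second (hw : ∀ q, 0 < w q) (asymm : ∀ x y, r x y → ¬ r y x)
    (total : ∀ x y, x ≠ y → r x y ∨ r y x) {l : List Q} {f j : Q}
    (hm : IsMedian r w (l ++ [f])) (hnd : (l ++ [f]).Nodup) (hall : ∀ q, q ∈ l ++ [f])
    (hf : w f = 1) (hj : r f j) : ∃ g, g ≠ f ∧ HasWeightedSNP r w g := by
  classical
  -- The number of entries from `j` on; minimizing it places `j` as late as possible.
  let after : List Q → ℕ := fun l' => (l'.dropWhile fun q => decide (q ≠ j)).length
  obtain ⟨l', ⟨hl', hml'⟩, hmin⟩ := exists_minimalFor_of_wellFoundedLT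
    (fun l' : List Q => l'.Perm l ∧ IsMedian r w l') after ⟨l, List.Perm.refl l, hm.left⟩
  have hfl : f ∉ l := fun h => List.disjoint_of_nodup_append hnd h (by simp)
  have hjf : j ≠ f := by
    rintro rfl
    exact asymm _ _ hj hj
  have hjl : j ∈ l := by simpa [hjf] using hall j
  have hall' : ∀ q, q ≠ f → q ∈ l' := fun q hq => hl'.symm.subset (by simpa [hq] using hall q)
  have hnd' : l'.Nodup := hl'.nodup_iff.2 (hnd.sublist (List.sublist_append_left _ _))
  obtain ⟨k, y, rfl⟩ : ∃ k y, l' = k ++ [y] := by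
    rcases List.eq_nil_or_concat l' with rfl | ⟨k, y, h⟩
    · exact absurd (hall' j hjf) (by simp)
    · exact ⟨k, y, by simpa using h⟩
  have hyf : y ≠ f := by
    rintro rfl
    exact hfl (hl'.subset (by simp))
  have hyk : y ∉ k := fun h => List.disjoint_of_nodup_append hnd' h (by simp)
  obtain ⟨B, G, h1, h2, h3, h4, h5, h6⟩ := hml'.sediment hw total y k [] hnd' (by simp)
  simp only [List.nil_append] at h1 h2
  have hBG : (B ++ G).Nodup := h1.nodup_iff.1 (hnd'.sublist (List.sublist_append_left _ _))
  have hGy : ∀ q ∈ G, q ≠ y := by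
    rintro q hq rfl
    exact hyk (h2.subset hq)
  have hout : ∀ q, q ≠ f → r y q → q ∈ G := fun q hq hyq => by
    have : q ∈ k := by
      have := hall' q hq
      rw [List.mem_append, List.mem_singleton] at this
      refine this.resolve_right ?_
      rintro rfl
      exact asymm _ _ hyq hyq
    exact (List.mem_append.1 (h1.subset this)).resolve_left fun hB => asymm _ _ hyq (h3 q hB)
  have hgood : ∀ q ∈ G, r q y → q ≠ y ∧ ¬ r y q ∧ ∃ u, r y u ∧ r u q := fun q hq hqy => by
    obtain ⟨u, -, hu⟩ := (h4 q hq).resolve_left (asymm _ _ hqy)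
    exact ⟨hGy q hq, asymm _ _ hqy, u, hu⟩
  have hGnd : (G.filter fun q => decide (r q y)).Nodup :=
    (hBG.sublist (List.sublist_append_right _ _)).filter _
  refine ⟨y, hyf, fun S T hS hT => ?_⟩
  by_cases hfy : r f y
  · refine (sum_le_of_subset_toFinset (L := G.filter fun q => decide (r y q))
      fun q hq => ?_).trans (h5.trans (sum_le_of_toFinset_subset hGnd fun q hq => ?_))
    · have hyq := (hS q).1 hq
      have hqf : q ≠ f := by
        rintro rfl
        exact asymm _ _ hfy hyq
      simpa [hyq] using hout q hqf hyq
    · simp only [List.mem_filter, decide_eq_true_eq] at hq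
      exact (hT q).2 (hgood q hq.1 hq.2)
  -- Here `f` adds exactly one to the out-weight of `y`, and this one has to be recovered.
  · have hyf' : r y f := (total y f hyf).resolve_right hfy
    have hjy : j ≠ y := by
      rintro rfl
      exact hfy hj
    have hS' : ∑ q ∈ S, w q ≤ outWeight r w y G + 1 := by
      refine (sum_le_of_subset_toFinset (L := f :: G.filter fun q => decide (r y q))
        fun q hq => ?_).trans ?_
      · have hyq := (hS q).1 hq
        by_cases hqf : q = f
        · simp [hqf]
        · simpa [hyq, hqf] using hout q hqf hyq
      · simp [outWeight, hf, add_comm]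
    have hT' : inWeight r w y G ≤ ∑ q ∈ T, w q :=
      sum_le_of_toFinset_subset hGnd fun q hq => by
        simp only [List.mem_filter, decide_eq_true_eq] at hq
        exact (hT q).2 (hgood q hq.1 hq.2)
    rcases h5.lt_or_eq with hlt | heq
    · omega
    have hjk : j ∈ k := by simpa [hjy] using hall' j hjf
    have hperm : (B ++ y :: G).Perm (k ++ [y]) :=
      List.perm_middle.trans ((h1.symm.cons y).trans (List.perm_append_singleton y k).symm)
    -- For `j` in `B`, the path from `y` through `f` makes `j` a second out-neighbour not counted in
    -- `G`. For `j` in `G`, the sedimented order is a median order with `j` later, against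
    -- minimality.
    rcases List.mem_append.1 (h1.subset hjk) with hjB | hjG
    · have hjG : j ∉ G := fun h => List.disjoint_of_nodup_append hBG hjB h
      have : inWeight r w y G + w j ≤ ∑ q ∈ T, w q := by
        have := sum_le_of_toFinset_subset (w := w) (S := T)
          (L := j :: G.filter fun q => decide (r q y))
          (List.nodup_cons.2 ⟨fun h => hjG (List.mem_filter.1 h).1, hGnd⟩) (by
            intro q hq
            rcases List.mem_cons.1 hq with rfl | hq
            · exact (hT q).2 ⟨hjy, asymm _ _ (h3 q hjB), f, hyf', hj⟩
            · simp only [List.mem_filter, decide_eq_true_eq] at hq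
              exact (hT q).2 (hgood q hq.1 hq.2))
        simpa [inWeight, add_comm] using this
      have := hw j
      omega
    · have hjB : j ∉ B := fun h => List.disjoint_of_nodup_append hBG h hjG
      have e1 : after (B ++ y :: G) = after G := by
        have hB : ∀ q ∈ B ++ [y], decide (q ≠ j) = true := by
          intro q hq
          rw [List.mem_append, List.mem_singleton] at hq
          rw [decide_eq_true_eq]
          rintro rfl
          rcases hq with h | h
          exacts [hjB h, hjy h]
        have : B ++ y :: G = (B ++ [y]) ++ G := by simp
        simp only [after]
        rw [this, List.dropWhile_append_of_pos hB]
      have e2 : after (k ++ [y]) = after k + 1 := by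
        simp only [after]
        rw [List.dropWhile_append]
        have : ¬ (k.dropWhile fun q => decide (q ≠ j)) = [] := by
          rw [List.dropWhile_eq_nil_iff]
          intro h
          simpa using h j hjk
        rw [if_neg (by rwa [List.isEmpty_iff])]
        simp
      have e3 : after G ≤ after k := length_dropWhile_le h2
      have := hmin (j := B ++ y :: G) ⟨hperm.trans hl', h6 heq⟩ (by omega)
      omega

end MedianOrder

/-! ### Flags, transport of arcs, and cyclic systems -/

namespace ArcRelation

open Relation

variable {V : Type*} {A : V → V → Prop} {S : V → V → Prop}

/-- `x` and `y` are distinct and joined by no arc. -/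
def Missing (A : V → V → Prop) (x y : V) : Prop :=
  x ≠ y ∧ ¬ A x y ∧ ¬ A y x

/-- There is neither an arc nor a directed path with two arcs from `x` to `y`. -/
def Far (A : V → V → Prop) (x y : V) : Prop :=
  ¬ A x y ∧ ∀ z, A x z → ¬ A z y

/-- A flag is a missing edge with a chosen end, which is the first component of the pair.
The flag `(x, y)` loses to the flag `(b, a)` if `x → a`, `y → b`, `b` is far from `x` and `a` is
far from `y`. -/
structure FlagArc (A : V → V → Prop) (p q : V × V) : Prop where
  left : Missing A p.1 p.2
  right : Missing A q.1 q.2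
  arc_fst : A p.1 q.2
  far_fst : Far A p.1 q.1
  arc_snd : A p.2 q.1
  far_snd : Far A p.2 q.2

theorem Missing.symm {x y : V} (h : Missing A x y) : Missing A y x :=
  ⟨h.1.symm, h.2.2, h.2.1⟩

theorem adj_of_not_missing {x y : V} (hne : x ≠ y) (h : ¬ Missing A x y) : A x y ∨ A y x := by
  by_contra hc
  push Not at hc
  exact h ⟨hne, hc⟩

/-- An arc from `z` to `y` would complete a two-arc path from `x` to `y`. With `Far.into`, this is
the rule that carries arcs along the dependency relation. -/
theorem Far.out {x y z : V} (h : Far A x y) (hz : A x z) (hm : ¬ Missing A y z) : A y z :=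
  (adj_of_not_missing (by rintro rfl; exact h.1 hz) hm).resolve_right (h.2 z hz)

theorem Far.into {x y z : V} (h : Far A x y) (hz : A z y) (hm : ¬ Missing A x z) : A z x :=
  (adj_of_not_missing (by rintro rfl; exact h.1 hz) hm).resolve_left fun hxz => h.2 z hxz hz

theorem Far.adj {x y : V} (h : Far A x y) (hne : x ≠ y) (hm : ¬ Missing A x y) : A y x :=
  (adj_of_not_missing hne hm).resolve_left h.1

theorem FlagArc.swap {p q : V × V} (h : FlagArc A p q) : FlagArc A p.swap q.swap :=
  ⟨h.left.symm, h.right.symm, h.arc_snd, h.far_snd, h.arc_fst, h.far_fst⟩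

theorem swap_path {p q : V × V} (h : ReflTransGen (FlagArc A) p q) :
    ReflTransGen (FlagArc A) p.swap q.swap :=
  h.lift Prod.swap fun _ _ h => h.swap

theorem missing_reverse {x y : V} : Missing (fun u v => A v u) x y ↔ Missing A x y :=
  ⟨fun h => ⟨h.1, h.2.2, h.2.1⟩, fun h => ⟨h.1, h.2.2, h.2.1⟩⟩

theorem far_reverse {x y : V} : Far (fun u v => A v u) x y ↔ Far A y x :=
  ⟨fun h => ⟨h.1, fun z h1 h2 => h.2 z h2 h1⟩, fun h => ⟨h.1, fun z h1 h2 => h.2 z h2 h1⟩⟩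

theorem flagArc_reverse {p q : V × V} : FlagArc (fun u v => A v u) p q ↔ FlagArc A q p :=
  ⟨fun h => ⟨missing_reverse.1 h.right, missing_reverse.1 h.left, h.arc_snd,
      far_reverse.1 h.far_fst, h.arc_fst, far_reverse.1 h.far_snd⟩,
    fun h => ⟨missing_reverse.2 h.right, missing_reverse.2 h.left, h.arc_snd,
      far_reverse.2 h.far_fst, h.arc_fst, far_reverse.2 h.far_snd⟩⟩

theorem path_reverse {p q : V × V} :
    ReflTransGen (FlagArc fun u v => A v u) p q ↔ ReflTransGen (FlagArc A) q p := by
  have : FlagArc (fun u v => A v u) = Function.swap (FlagArc A) := by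
    ext p q
    exact flagArc_reverse
  rw [this, reflTransGen_swap]

/-- `A` is the arc relation of an oriented graph whose missing graph consists of disjoint paths
with at most two edges. -/
structure PathSystem (A : V → V → Prop) : Prop where
  asymm : ∀ x y, A x y → ¬ A y x
  end_unique : ∀ {a b c w}, Missing A a b → Missing A b c → a ≠ c → Missing A a w → w = b
  mid_unique : ∀ {a b c w}, Missing A a b → Missing A b c → a ≠ c → Missing A b w →
    w = a ∨ w = c

theorem PathSystem.reverse (h : PathSystem A) : PathSystem fun u v => A v u where
  asymm x y := h.asymm y x
  end_unique h1 h2 h3 h4 := h.end_unique (missing_reverse.1 h1) (missing_reverse.1 h2) h3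
    (missing_reverse.1 h4)
  mid_unique h1 h2 h3 h4 := h.mid_unique (missing_reverse.1 h1) (missing_reverse.1 h2) h3
    (missing_reverse.1 h4)

/-- A family `S` of flags, closed under the dependency relation and under passing to the other
missing edge of a missing path, on which the dependency relation is a permutation with strongly
connected orbits. -/
structure CyclicSystem (A S : V → V → Prop) : Prop extends PathSystem A where
  symm : ∀ {x y}, S x y → S y x
  missing : ∀ {x y}, S x y → Missing A x y
  path : ∀ {x y z}, S x y → Missing A y z → S y z
  fwd : ∀ {p q : V × V}, S p.1 p.2 → FlagArc A p q → S q.1 q.2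
  bwd : ∀ {p q : V × V}, S q.1 q.2 → FlagArc A p q → S p.1 p.2
  exists_succ : ∀ {p : V × V}, S p.1 p.2 → ∃ q, FlagArc A p q
  exists_pred : ∀ {p : V × V}, S p.1 p.2 → ∃ q, FlagArc A q p
  succ_unique : ∀ {p q q' : V × V}, S p.1 p.2 → FlagArc A p q → FlagArc A p q' → q = q'
  pred_unique : ∀ {p q q' : V × V}, S p.1 p.2 → FlagArc A q p → FlagArc A q' p → q = q'
  conn : ∀ {p q : V × V}, S p.1 p.2 → ReflTransGen (FlagArc A) p q →
    ReflTransGen (FlagArc A) q p ∨ ReflTransGen (FlagArc A) q p.swap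

theorem CyclicSystem.fwd_path (h : CyclicSystem A S) {p q : V × V} (hp : S p.1 p.2)
    (hpq : ReflTransGen (FlagArc A) p q) : S q.1 q.2 := by
  induction hpq with
  | refl => exact hp
  | tail _ h2 ih => exact h.fwd ih h2

theorem CyclicSystem.bwd_path (h : CyclicSystem A S) {p q : V × V} (hq : S q.1 q.2)
    (hpq : ReflTransGen (FlagArc A) p q) : S p.1 p.2 := by
  induction hpq using ReflTransGen.head_induction_on with
  | refl => exact hq
  | head h1 _ ih => exact h.bwd ih h1

theorem CyclicSystem.reverse (h : CyclicSystem A S) : CyclicSystem (fun u v => A v u) S where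
  toPathSystem := h.toPathSystem.reverse
  symm := h.symm
  missing hS := missing_reverse.2 (h.missing hS)
  path h1 h2 := h.path h1 (missing_reverse.1 h2)
  fwd h1 h2 := h.bwd h1 (flagArc_reverse.1 h2)
  bwd h1 h2 := h.fwd h1 (flagArc_reverse.1 h2)
  exists_succ h1 := (h.exists_pred h1).imp fun _ => flagArc_reverse.2
  exists_pred h1 := (h.exists_succ h1).imp fun _ => flagArc_reverse.2
  succ_unique h1 h2 h3 := h.pred_unique h1 (flagArc_reverse.1 h2) (flagArc_reverse.1 h3)
  pred_unique h1 h2 h3 := h.succ_unique h1 (flagArc_reverse.1 h2) (flagArc_reverse.1 h3)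
  conn {p q} h1 h2 := by
    simp only [path_reverse] at h2 ⊢
    refine (h.conn (h.bwd_path h1 h2) h2).imp id fun h3 => ?_
    simpa using swap_path h3

/-- If the orbit of the flag `(r, z)` meets the missing path of `r` only in the edge `rz`, then it
contains `(z, r)`. -/
theorem CyclicSystem.path_swap (h : CyclicSystem A S) {r z : V} (hrz : S r z)
    (hw : ∀ p, ReflTransGen (FlagArc A) (r, z) p → p.1 = r ∨ Missing A r p.1 →
      p = (r, z) ∨ p = (z, r)) :
    ReflTransGen (FlagArc A) (r, z) (z, r) := by
  by_contra hc
  obtain ⟨q, hq⟩ := h.exists_succ (p := (r, z)) hrz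
  have hm := h.missing hrz
  -- The arc into `r` created at `q` persists along the orbit, which must nevertheless return to `r`
  -- or to `z`.
  have key : ∀ p, ReflTransGen (FlagArc A) q p → A p.1 r := by
    intro p hp
    induction hp with
    | refl =>
      have hqr : q.1 ≠ r := fun e => hm.2.2 (e ▸ hq.arc_snd)
      refine hq.far_fst.adj hqr.symm fun hmq => ?_
      rcases hw q (.single hq) (Or.inr hmq) with rfl | rfl
      exacts [hqr rfl, hc (.single hq)]
    | @tail p p' h1 h2 ih =>
      refine h2.far_fst.out ih fun hmq => ?_
      rcases hw p' (.head hq (h1.tail h2)) (Or.inr hmq.symm) with rfl | rfl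
      exacts [hmq.1 rfl, hc (.head hq (h1.tail h2))]
  rcases h.conn hrz (.single hq) with h1 | h1
  · have := key _ h1
    exact h.asymm _ _ this this
  · exact hm.2.2 (key _ h1)

/-- A missing path `abc` with `a → c`, both edges of which belong to a cyclic system. -/
structure CyclicPath (A S : V → V → Prop) (a b c : V) : Prop extends CyclicSystem A S where
  left : S a b
  right : S b c
  arc : A a c

/-! ### No missing path of length two has its edges on directed cycles -/

namespace CyclicPath

variable {a b c : V}

theorem reverse (h : CyclicPath A S a b c) : CyclicPath (fun u v => A v u) S c b a where
  toCyclicSystem := h.toCyclicSystem.reverse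
  left := h.symm h.right
  right := h.symm h.left
  arc := h.arc

theorem ne (h : CyclicPath A S a b c) : a ≠ c := by
  rintro rfl
  exact h.asymm _ _ h.arc h.arc

theorem missing_left (h : CyclicPath A S a b c) : Missing A a b := h.missing h.left

theorem missing_right (h : CyclicPath A S a b c) : Missing A b c := h.missing h.right

theorem eq_of_missing_left (h : CyclicPath A S a b c) {w : V} (hw : Missing A a w) : w = b :=
  h.end_unique h.missing_left h.missing_right h.ne hw

theorem eq_of_missing_right (h : CyclicPath A S a b c) {w : V} (hw : Missing A c w) : w = b :=
  h.end_unique h.missing_right.symm h.missing_left.symm h.ne.symm hw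

theorem eq_of_missing_mid (h : CyclicPath A S a b c) {w : V} (hw : Missing A b w) :
    w = a ∨ w = c :=
  h.mid_unique h.missing_left h.missing_right h.ne hw

/-- The vertices of the missing path `abc`. -/
def Special (a b c x : V) : Prop :=
  x = a ∨ x = b ∨ x = c

theorem not_missing (h : CyclicPath A S a b c) {x y : V} (hx : ¬ Special a b c x)
    (hy : Special a b c y) : ¬ Missing A x y := by
  intro hm
  unfold Special at *
  rcases hy with rfl | rfl | rfl
  · exact hx (Or.inr (Or.inl (h.eq_of_missing_left hm.symm)))
  · exact hx ((h.eq_of_missing_mid hm.symm).imp id Or.inr)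
  · exact hx (Or.inr (Or.inl (h.eq_of_missing_right hm.symm)))

theorem special_swap (h : CyclicPath A S a b c) {x y : V} (hm : Missing A x y)
    (hx : Special a b c x) : Special a b c y := by
  by_contra hy
  exact h.not_missing hy hx hm.symm

theorem special_of_not_mid (h : CyclicPath A S a b c) {p : V × V} (hm : Missing A p.1 p.2)
    (hp : Special a b c p.1) (hb : p.1 ≠ b) : p = (a, b) ∨ p = (c, b) := by
  obtain ⟨x, y⟩ := p
  rcases hp with rfl | rfl | rfl
  · exact Or.inl (Prod.ext rfl (h.eq_of_missing_left hm))
  · exact absurd rfl hb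
  · exact Or.inr (Prod.ext rfl (h.eq_of_missing_right hm))

theorem flag_special (h : CyclicPath A S a b c) {p : V × V} (hm : Missing A p.1 p.2)
    (hp : Special a b c p.1) : S p.1 p.2 := by
  obtain ⟨x, y⟩ := p
  rcases hp with rfl | rfl | rfl
  · exact h.path (h.symm h.left) hm
  · exact h.path h.left hm
  · exact h.path h.right hm

/-- One end of a special edge is `b`, and no arc joins `b` to the path. -/
theorem not_special_of_flagArc (h : CyclicPath A S a b c) {p q : V × V} (hpq : FlagArc A p q)
    (hp : Special a b c p.1) : ¬ Special a b c q.1 := by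
  intro hq
  have hp' := h.special_swap hpq.left hp
  have hq' := h.special_swap hpq.right hq
  have key : ∀ x, Special a b c x → x = b ∨ Missing A x b := by
    rintro x (rfl | rfl | rfl)
    exacts [Or.inr h.missing_left, Or.inl rfl, Or.inr h.missing_right.symm]
  have hb : ∀ x, A b x → ¬ Special a b c x := by
    rintro x hx hs
    rcases key x hs with rfl | hm
    exacts [h.asymm _ _ hx hx, hm.2.2 hx]
  have hb' : ∀ x, A x b → ¬ Special a b c x := by
    rintro x hx hs
    rcases key x hs with rfl | hm
    exacts [h.asymm _ _ hx hx, hm.2.1 hx]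
  have hpb : p.1 = b ∨ p.2 = b := by
    by_contra hc
    push Not at hc
    rcases h.special_of_not_mid hpq.left hp hc.1 with rfl | rfl <;> exact hc.2 rfl
  rcases hpb with e | e
  · exact hb _ (e ▸ hpq.arc_fst) hq'
  · exact hb _ (e ▸ hpq.arc_snd) hq

/-- On the flags with a path to a special flag, the in-neighbours of `b` are out-neighbours
of `a`. -/
theorem arc_of_arc_mid (h : CyclicPath A S a b c) {p s : V × V}
    (hps : ReflTransGen (FlagArc A) p s) (hs : Special a b c s.1) (hp : ¬ Special a b c p.1)
    (hpb : A p.1 b) : A a p.1 := by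
  induction hps using ReflTransGen.head_induction_on with
  | refl => exact absurd hs hp
  | @head p q h1 _ ih =>
    have ha := h.not_missing hp (Or.inl rfl)
    by_cases hq : Special a b c q.1
    · by_cases hqb : q.1 = b
      · exact absurd hpb (hqb ▸ h1.far_fst).1
      · have hpa : p.1 ≠ a := fun e => hp (Or.inl e)
        rcases h.special_of_not_mid h1.right hq hqb with rfl | rfl
        · exact h1.far_fst.adj hpa ha
        · exact h1.far_fst.into h.arc ha
    · exact h1.far_fst.into (ih hq (h1.far_fst.out hpb (h.not_missing hq (Or.inr (Or.inl rfl))))) ha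

/-- On the flags with a path from a special flag, the out-neighbours of `b` are in-neighbours
of `c`. -/
theorem arc_of_mid_arc (h : CyclicPath A S a b c) {p s : V × V}
    (hps : ReflTransGen (FlagArc A) s p) (hs : Special a b c s.1) (hp : ¬ Special a b c p.1)
    (hpb : A b p.1) : A p.1 c :=
  h.reverse.arc_of_arc_mid (path_reverse.2 hps) (by unfold Special at *; tauto)
    (by unfold Special at *; tauto) hpb

/-- A flag in the orbit of a special flag is both on a path to and on a path from a special
flag. -/
theorem exists_special_of_path (h : CyclicPath A S a b c) {p s : V × V} (hp : S p.1 p.2)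
    (hps : ReflTransGen (FlagArc A) p s) (hs : Special a b c s.1) :
    ∃ s', ReflTransGen (FlagArc A) s' p ∧ Special a b c s'.1 := by
  rcases h.conn hp hps with h1 | h1
  · exact ⟨s, h1, hs⟩
  · exact ⟨s.swap, by simpa using swap_path h1,
      h.special_swap (h.missing (h.fwd_path hp hps)) hs⟩

/-- The vertices of the orbits of the special flags do not lie on a directed path from `c`
to `a`. -/
theorem not_between_of_path (h : CyclicPath A S a b c) {z y : V} {s : V × V} (hzy : S z y)
    (hps : ReflTransGen (FlagArc A) (z, y) s) (hs : Special a b c s.1) (h1 : A c z) :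
    ¬ A z a := by
  intro h2
  have hz : ¬ Special a b c z := by
    rintro (rfl | rfl | rfl)
    exacts [h.asymm _ _ h.arc h1, h.missing_right.2.2 h1, h.asymm _ _ h1 h1]
  have hzb : z ≠ b := fun e => hz (Or.inr (Or.inl e))
  rcases adj_of_not_missing hzb (h.not_missing hz (Or.inr (Or.inl rfl))) with h3 | h3
  · exact h.asymm _ _ h2 (h.arc_of_arc_mid hps hs hz h3)
  · obtain ⟨s', hs', hs''⟩ := h.exists_special_of_path hzy hps hs
    exact h.asymm _ _ h1 (h.arc_of_mid_arc hs' hs'' hz h3)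

/-- The steps of the dependency relation ending in a flag that is not special. -/
def Step (A : V → V → Prop) (a b c : V) (p q : V × V) : Prop :=
  FlagArc A p q ∧ ¬ Special a b c q.1

theorem path_of_steps {p q : V × V} (h : ReflTransGen (Step A a b c) p q) :
    ReflTransGen (FlagArc A) p q :=
  ReflTransGen.mono (fun _ _ h => h.1) _ _ h

theorem exists_next_special {x s p r : V × V} (h : ReflTransGen (FlagArc A) x s)
    (hs : Special a b c s.1) (hpr : ReflTransGen (Step A a b c) p r) (hrx : FlagArc A r x) :
    ∃ r' q, ReflTransGen (Step A a b c) p r' ∧ FlagArc A r' q ∧ Special a b c q.1 := by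
  induction h using ReflTransGen.head_induction_on generalizing r with
  | refl => exact ⟨r, s, hpr, hrx, hs⟩
  | @head x x' h1 _ ih =>
    by_cases hx : Special a b c x.1
    · exact ⟨r, x, hpr, hrx, hx⟩
    · exact ih (hpr.tail ⟨hrx, hx⟩) h1

/-- The orbit of a special flag returns to it or to its swap, so it can be cut at the first special
flag after its start. -/
theorem exists_next (h : CyclicPath A S a b c) {p : V × V} (hm : Missing A p.1 p.2)
    (hp : Special a b c p.1) :
    ∃ r q, ReflTransGen (Step A a b c) p r ∧ FlagArc A r q ∧ Special a b c q.1 := by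
  have hS := h.flag_special hm hp
  obtain ⟨q, hq⟩ := h.exists_succ hS
  rcases h.conn hS (.single hq) with h1 | h1
  · exact exists_next_special h1 hp .refl hq
  · exact exists_next_special h1 (h.special_swap hm hp) .refl hq

/-- Predecessors are unique, so both chains retreat together until a special flag is met, which can
only be the start of each. Hence the first-return map on special flags is injective. -/
theorem eq_of_steps (h : CyclicPath A S a b c) {p p' r : V × V} (hp : Special a b c p.1)
    (hp' : Special a b c p'.1) (hm : Missing A p.1 p.2) (h1 : ReflTransGen (Step A a b c) p r)
    (h2 : ReflTransGen (Step A a b c) p' r) : p = p' := by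
  induction h1 with
  | refl =>
    rcases h2.cases_tail with h2 | ⟨q, -, h2⟩
    · exact h2
    · exact absurd hp h2.2
  | @tail r r' h3 h4 ih =>
    rcases h2.cases_tail with rfl | ⟨q, h5, h6⟩
    · exact absurd hp' h4.2
    · have hS := h.fwd_path (h.flag_special hm hp) ((path_of_steps h3).tail h4.1)
      obtain rfl := h.pred_unique hS h4.1 h6.1
      exact ih h5

theorem arc_mid_of_steps (h : CyclicPath A S a b c) {y : V} {r : V × V}
    (hr : ReflTransGen (Step A a b c) (b, y) r) : r = (b, y) ∨ A r.1 b := by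
  induction hr with
  | refl => exact Or.inl rfl
  | @tail r r' h1 h2 ih =>
    have hm := h.not_missing h2.2 (Or.inr (Or.inl rfl))
    right
    rcases ih with rfl | ih
    · exact h2.1.far_fst.adj (fun e => h2.2 (Or.inr (Or.inl e.symm))) fun h => hm h.symm
    · exact h2.1.far_fst.out ih hm

/-- After the flag `(a, b)` or `(c, b)`, the first special flag is one of the flags at `b`. -/
theorem next_eq_mid (h : CyclicPath A S a b c) {p r q : V × V} (hm : Missing A p.1 p.2)
    (hp : Special a b c p.1) (hpb : p.1 ≠ b) (hr : ReflTransGen (Step A a b c) p r)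
    (hrq : FlagArc A r q) (hq : Special a b c q.1) : q.1 = b := by
  by_contra hqb
  -- There are four special flags. Those at `b` cannot return at `b`, since `b` is an out-neighbour
  -- of the flag before the return. By injectivity they take both `(a, b)` and `(c, b)`, leaving
  -- neither for `p`.
  have next : ∀ y, Missing A b y → ∃ r q, ReflTransGen (Step A a b c) (b, y) r ∧ FlagArc A r q ∧
      (q = (a, b) ∨ q = (c, b)) := by
    intro y hy
    obtain ⟨r, q, h1, h2, h3⟩ := h.exists_next (p := (b, y)) hy (Or.inr (Or.inl rfl))
    refine ⟨r, q, h1, h2, h.special_of_not_mid h2.right h3 fun e => ?_⟩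
    rcases h.arc_mid_of_steps h1 with rfl | h4
    · exact h.not_special_of_flagArc h2 (Or.inr (Or.inl rfl)) h3
    · exact (e ▸ h2.far_fst).1 h4
  have inj : ∀ {p p' r r' q : V × V}, Missing A p.1 p.2 → Special a b c p.1 →
      Special a b c p'.1 → ReflTransGen (Step A a b c) p r → ReflTransGen (Step A a b c) p' r' →
      FlagArc A r q → FlagArc A r' q → p = p' := by
    intro p p' r r' q hm hp hp' hr hr' hq hq'
    have hS := h.fwd (h.fwd_path (h.flag_special hm hp) (path_of_steps hr)) hq
    obtain rfl := h.pred_unique hS hq hq'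
    exact h.eq_of_steps hp hp' hm hr hr'
  obtain ⟨r₁, q₁, g1, g2, g3⟩ := next a h.missing_left.symm
  obtain ⟨r₂, q₂, k1, k2, k3⟩ := next c h.missing_right
  have hb : ∀ y : V, Special a b c (b, y).1 := fun y => Or.inr (Or.inl rfl)
  have hne : q₁ ≠ q₂ := by
    rintro rfl
    have := inj (p := (b, a)) (p' := (b, c)) h.missing_left.symm (hb a) (hb c) g1 k1 g2 k2
    exact h.ne (Prod.mk.inj this).2
  have hq' := h.special_of_not_mid hrq.right hq hqb
  have : q = q₁ ∨ q = q₂ := by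
    rcases g3 with rfl | rfl <;> rcases k3 with rfl | rfl <;> rcases hq' with rfl | rfl <;> simp_all
  rcases this with rfl | rfl
  · exact hpb (by rw [inj hm hp (hb a) hr g1 hrq g2])
  · exact hpb (by rw [inj hm hp (hb c) hr k1 hrq k2])

/-- The first special flag after `(c, b)` sits at `b`. Going backwards from it, the arc from `z` to
`b` becomes an arc from `z` to the vertex of each flag in between. The first of these vertices is
then reached from `c` through `z`, although it is far from `c`. -/
theorem not_between_of_arc_mid (h : CyclicPath A S a b c) {z : V} (hcz : A c z) (hza : A z a)
    (hzb : A z b) : False := by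
  have hc : Special a b c (c, b).1 := Or.inr (Or.inr rfl)
  have hcb : (c, b).1 ≠ b := h.missing_right.1.symm
  obtain ⟨r, q, hr, hrq, hq⟩ := h.exists_next (p := (c, b)) h.missing_right.symm hc
  have hqb := h.next_eq_mid h.missing_right.symm hc hcb hr hrq hq
  have hSq := h.flag_special hrq.right hq
  have hz : ∀ {y s}, S z y → ReflTransGen (FlagArc A) (z, y) s → ¬ Special a b c s.1 :=
    fun h1 h2 h3 => h.not_between_of_path h1 h2 h3 hcz hza
  -- The transport requires that `z` is not a missing neighbour of these vertices. If it were one of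
  -- `x`, the orbit of `xz` would avoid the other neighbour `y`, since `xy` leads to a special flag
  -- and `xz` does not. By `path_swap` it would lead from `z` to `x`, carrying the arc from `z` to
  -- `b` to one from `x` to `b`.
  have hnm : ∀ p : V × V, ReflTransGen (FlagArc A) p q → ¬ Special a b c p.1 → A b p.1 →
      ¬ Missing A p.1 z := by
    rintro ⟨x, y⟩ hp hx hbx hxz
    have hS : S x y := h.bwd_path hSq hp
    have hyz : y ≠ z := by
      rintro rfl
      exact hz (h.symm hS) (swap_path hp) (h.special_swap hrq.right hq)
    have hSxz : S x z := h.path (h.symm hS) hxz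
    have hno : ∀ s, ReflTransGen (FlagArc A) (x, z) s → ¬ Special a b c s.1 := fun s hs hs' =>
      hz (h.symm hSxz) (swap_path hs) (h.special_swap (h.missing (h.fwd_path hSxz hs)) hs')
    have hpath : ReflTransGen (FlagArc A) (x, z) (z, x) := by
      refine h.path_swap hSxz ?_
      rintro ⟨u, v⟩ hp' huv
      have hm : Missing A u v := h.missing (h.fwd_path hSxz hp')
      have hyx := (h.missing hS).symm
      have hnoy : v ≠ y → u ≠ y → (u, v) = (x, z) ∨ (u, v) = (z, x) := by
        intro hvy huy
        rcases huv with e | hxu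
        · obtain rfl : u = x := e
          exact Or.inl (Prod.ext rfl ((h.mid_unique hyx hxz hyz hm).resolve_left hvy))
        · obtain rfl : u = z := (h.mid_unique hyx hxz hyz hxu).resolve_left huy
          exact Or.inr (Prod.ext rfl (h.end_unique hxz.symm hyx.symm hyz.symm hm))
      refine hnoy ?_ ?_
      · rintro rfl
        have : u = x := h.end_unique hyx hxz hyz hm.symm
        subst this
        exact hno _ (hp'.trans hp) hq
      · rintro rfl
        have : v = x := h.end_unique hyx hxz hyz hm
        subst this
        exact hno _ (hp'.trans (swap_path hp)) (h.special_swap hrq.right hq)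
    have hb : ∀ s, ReflTransGen (FlagArc A) (z, x) s → A s.1 b := by
      intro s hs
      induction hs with
      | refl => exact hzb
      | tail h1 h2 ih =>
        exact h2.far_fst.out ih
          (h.not_missing (hno _ (hpath.trans (h1.tail h2))) (Or.inr (Or.inl rfl)))
    exact h.asymm _ _ hbx (hb (x, z) (swap_path hpath))
  have key : ∀ p, ReflTransGen (Step A a b c) p r → ¬ Special a b c p.1 → A b p.1 ∧ A z p.1 := by
    intro p hp
    induction hp using ReflTransGen.head_induction_on with
    | refl =>
      intro hns
      have hfar : Far A r.1 b := hqb ▸ hrq.far_fst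
      have h1 : A b r.1 := hfar.adj (fun e => hns (Or.inr (Or.inl e)))
        (h.not_missing hns (Or.inr (Or.inl rfl)))
      exact ⟨h1, hfar.into hzb (hnm r (.single hrq) hns h1)⟩
    | @head p p' h1 h2 ih =>
      intro hns
      obtain ⟨ih1, ih2⟩ := ih h1.2
      have h3 := h1.1.far_fst.into ih1 (h.not_missing hns (Or.inr (Or.inl rfl)))
      exact ⟨h3, h1.1.far_fst.into ih2
        (hnm p (.head h1.1 ((path_of_steps h2).tail hrq)) hns h3)⟩
  rcases hr.cases_head with rfl | ⟨p, h1, h2⟩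
  · exact h.not_special_of_flagArc hrq hc hq
  · exact h1.1.far_fst.2 z hcz (key p h2 h1.2).2

/-- There is no directed path with two arcs from `c` to `a`. -/
theorem not_between (h : CyclicPath A S a b c) {z : V} (hcz : A c z) : ¬ A z a := by
  intro hza
  have hz : ¬ Special a b c z := by
    rintro (rfl | rfl | rfl)
    exacts [h.asymm _ _ h.arc hcz, h.missing_right.2.2 hcz, h.asymm _ _ hcz hcz]
  rcases adj_of_not_missing (fun e => hz (Or.inr (Or.inl e)))
    (h.not_missing hz (Or.inr (Or.inl rfl))) with h1 | h1
  · exact h.not_between_of_arc_mid hcz hza h1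
  · exact h.reverse.not_between_of_arc_mid hza hcz h1

/-- Otherwise `(c, b)` would also lose to `q`, because `not_between` makes `q.1` far from `c`; this
contradicts uniqueness of predecessors. -/
theorem arc_of_succ_left (h : CyclicPath A S a b c) {q : V × V} (hq : FlagArc A (a, b) q) :
    A q.2 c := by
  have hn : ¬ Special a b c q.1 := h.not_special_of_flagArc hq (Or.inl rfl)
  have hn2 : ¬ Special a b c q.2 := fun h' => hn (h.special_swap hq.right.symm h')
  have hc : Special a b c c := Or.inr (Or.inr rfl)
  refine (adj_of_not_missing (fun e => hn2 (Or.inr (Or.inr e))) (h.not_missing hn2 hc)).resolve_right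
    fun hcq => ?_
  have hfar : Far A c q.1 := by
    have h1 : A q.1 c := hq.far_fst.out h.arc (h.not_missing hn hc)
    refine ⟨h.asymm _ _ h1, fun z hcz hzq => h.not_between hcz (hq.far_fst.into hzq fun hm => ?_)⟩
    obtain rfl := h.eq_of_missing_left hm
    exact h.missing_right.2.2 hcz
  have hS := h.fwd (p := (a, b)) h.left hq
  have := h.pred_unique (q' := (c, b)) hS hq
    ⟨h.missing_right.symm, hq.right, hcq, hfar, hq.arc_snd, hq.far_snd⟩
  exact h.ne (Prod.mk.inj this).1

theorem arc_of_pred_right (h : CyclicPath A S a b c) {q : V × V} (hq : FlagArc A q (c, b)) :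
    A a q.2 :=
  h.reverse.arc_of_succ_left (flagArc_reverse.2 hq)

/-- Let `p` lose to `(c, b)`. The orbit of `(a, b)` next meets the path at `b`, and the arc from
`p.1` to `b` is carried back to all flags in between. As `a` dominates `p.1`, this gives a two-arc
path from `a` to the first of them, which is far from `a`. -/
theorem false (h : CyclicPath A S a b c) : False := by
  have ha : Special a b c (a, b).1 := Or.inl rfl
  obtain ⟨r, q, hr, hrq, hq⟩ := h.exists_next (p := (a, b)) h.missing_left ha
  have hqb := h.next_eq_mid h.missing_left ha h.missing_left.1 hr hrq hq
  obtain ⟨p, hp⟩ := h.exists_pred (p := (c, b)) (h.symm h.right)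
  have hp1 : ¬ Special a b c p.1 := fun hs =>
    h.not_special_of_flagArc hp hs (Or.inr (Or.inr rfl))
  have hap : A a p.1 := hp.far_fst.into h.arc (h.not_missing hp1 (Or.inl rfl))
  have hcp : A c p.1 := hp.far_fst.adj (fun e => hp1 (Or.inr (Or.inr e)))
    (h.not_missing hp1 (Or.inr (Or.inr rfl)))
  have hap2 := h.arc_of_pred_right hp
  have fwd : ∀ x, ReflTransGen (Step A a b c) (a, b) x → x = (a, b) ∨ A x.1 a ∧ A x.2 c := by
    intro x hx
    induction hx with
    | refl => exact Or.inl rfl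
    | @tail x y h1 h2 ih =>
      have hy2 : ¬ Special a b c y.2 := fun hs => h2.2 (h.special_swap h2.1.right.symm hs)
      have hm := h.not_missing h2.2 (Or.inl rfl)
      right
      rcases ih with rfl | ⟨ih1, ih2⟩
      · exact ⟨h2.1.far_fst.adj (fun e => h2.2 (Or.inl e.symm)) fun h => hm h.symm,
          h.arc_of_succ_left h2.1⟩
      · exact ⟨h2.1.far_fst.out ih1 hm,
          h2.1.far_snd.out ih2 (h.not_missing hy2 (Or.inr (Or.inr rfl)))⟩
  -- If `x.1` and `p.1` were missing neighbours, then `x.1 = p.2` or `x.2 = p.1`; the arcs of `fwd`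
  -- exclude both.
  have hnm : ∀ x, ReflTransGen (Step A a b c) (a, b) x → ¬ Special a b c x.1 →
      Missing A x.1 x.2 → ¬ Missing A x.1 p.1 := by
    intro x hx hns hm hxp
    obtain ⟨h1, h2⟩ := (fwd x hx).resolve_left fun e => hns (e ▸ ha)
    by_cases e : x.1 = p.2
    · exact h.asymm _ _ h1 (e ▸ hap2)
    · have := h.end_unique hxp hp.left e hm
      exact h.asymm _ _ hcp (this ▸ h2)
  have bwd : ∀ x, ReflTransGen (Step A a b c) x r → ReflTransGen (Step A a b c) (a, b) x →
      ¬ Special a b c x.1 → A p.1 x.1 := by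
    intro x hx
    induction hx using ReflTransGen.head_induction_on with
    | refl =>
      intro hx' hns
      exact hrq.far_fst.into (hqb ▸ hp.arc_fst) (hnm r hx' hns hrq.left)
    | @head x y h1 h2 ih =>
      intro hx' hns
      exact h1.1.far_fst.into (ih (hx'.tail h1) h1.2) (hnm x hx' hns h1.1.left)
  rcases hr.cases_head with rfl | ⟨x, h1, h2⟩
  · exact h.not_special_of_flagArc hrq ha hq
  · exact h1.1.far_fst.2 p.1 hap (bwd x h2 (.single h1) h1.2)

end CyclicPath

/-- The missing edges in a cyclic system are pairwise disjoint. -/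
theorem CyclicSystem.eq_of_missing (h : CyclicSystem A S) {a b c : V} (hab : S a b)
    (hbc : Missing A b c) : a = c := by
  by_contra hac
  have hab' := h.missing hab
  have hS := h.path hab hbc
  have hm : ¬ Missing A a c := fun hm => hbc.1 (h.end_unique hab' hbc hac hm).symm
  rcases adj_of_not_missing hac hm with h1 | h1
  · exact CyclicPath.false ⟨h, hab, hS, h1⟩
  · exact CyclicPath.false ⟨h, h.symm hS, h.symm hab, h1⟩

end ArcRelation

/-! ### Reachability classes and counting inside a class -/

namespace ArcRelation

open Relation

variable {V : Type*} {A : V → V → Prop}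

/-- An oriented graph whose missing graph consists of disjoint paths with at most two edges and
whose dependency digraph has no source and no sink and is a union of strongly connected components,
where the two edges of a missing path lose to the same edges and dominate the same edges. -/
structure DependencySystem (A : V → V → Prop) : Prop extends PathSystem A where
  exists_succ : ∀ {p : V × V}, Missing A p.1 p.2 → ∃ q, FlagArc A p q
  exists_pred : ∀ {p : V × V}, Missing A p.1 p.2 → ∃ q, FlagArc A q p
  conn : ∀ {p q : V × V}, FlagArc A p q →
    ReflTransGen (FlagArc A) q p ∨ ReflTransGen (FlagArc A) q p.swap
  twin_succ : ∀ {a b c : V} {q : V × V}, Missing A b c → FlagArc A (a, b) q → FlagArc A (c, b) q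
  twin_pred : ∀ {a b c : V} {q : V × V}, Missing A b c → FlagArc A q (a, b) → FlagArc A q (c, b)

/-- Some flag at `x` loses to some flag at `y`. -/
def VertexArc (A : V → V → Prop) (x y : V) : Prop :=
  ∃ x' y', FlagArc A (x, x') (y, y')

theorem vertexArc_reverse {x y : V} : VertexArc (fun u v => A v u) x y ↔ VertexArc A y x :=
  ⟨fun ⟨x', y', h⟩ => ⟨y', x', flagArc_reverse.1 h⟩,
    fun ⟨x', y', h⟩ => ⟨y', x', flagArc_reverse.2 h⟩⟩

/-- There is a chain of flags from `x` to `y`. -/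
def Reach (A : V → V → Prop) : V → V → Prop :=
  ReflTransGen (VertexArc A)

theorem reach_reverse {x y : V} : Reach (fun u v => A v u) x y ↔ Reach A y x := by
  have : VertexArc (fun u v => A v u) = Function.swap (VertexArc A) := by
    ext p q
    exact vertexArc_reverse
  rw [Reach, this, reflTransGen_swap, Reach]

theorem reach_of_path {p q : V × V} (h : ReflTransGen (FlagArc A) p q) : Reach A p.1 q.1 :=
  h.lift Prod.fst fun p q h => ⟨p.2, q.2, h⟩

namespace DependencySystem

variable (H : DependencySystem A)
include H

theorem reverse : DependencySystem fun u v => A v u where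
  toPathSystem := H.toPathSystem.reverse
  exists_succ h := (H.exists_pred (missing_reverse.1 h)).imp fun _ => flagArc_reverse.2
  exists_pred h := (H.exists_succ (missing_reverse.1 h)).imp fun _ => flagArc_reverse.2
  conn {p q} h := by
    simp only [path_reverse]
    refine (H.conn (flagArc_reverse.1 h)).imp id fun h3 => ?_
    simpa using swap_path h3
  twin_succ h1 h2 := flagArc_reverse.2 (H.twin_pred (missing_reverse.1 h1) (flagArc_reverse.1 h2))
  twin_pred h1 h2 := flagArc_reverse.2 (H.twin_succ (missing_reverse.1 h1) (flagArc_reverse.1 h2))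

/-- If no missing neighbour of `r` were reached, the arc into `r` created at the first step would
persist, yet the chain returns to `r` or `z`. -/
theorem reach_of_missing {r z : V} (hm : Missing A r z) : Reach A r z := by
  obtain ⟨q, hq⟩ := H.exists_succ (p := (r, z)) hm
  have h0 : VertexArc A r q.1 := ⟨z, q.2, hq⟩
  have h1 : ∃ w, Missing A r w ∧ Reach A r w := by
    by_contra hc
    push Not at hc
    have key : ∀ y, Reach A q.1 y → A y r := by
      intro y hy
      induction hy with
      | refl =>
        have hqr : r ≠ q.1 := fun e => hm.2.2 (e ▸ hq.arc_snd)
        exact hq.far_fst.adj hqr fun hmq => hc _ hmq (.single h0)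
      | @tail y y' h1 h2 ih =>
        obtain ⟨u, u', h3⟩ := h2
        exact h3.far_fst.out ih fun hmq => hc _ hmq.symm (.head h0 (h1.tail ⟨u, u', h3⟩))
    rcases H.conn hq with h1 | h1
    · have := key _ (reach_of_path h1)
      exact H.asymm _ _ this this
    · exact hm.2.2 (key _ (reach_of_path h1))
  obtain ⟨w, hw, hrw⟩ := h1
  rcases hrw.cases_tail with e | ⟨y, hy, u, u', h2⟩
  · exact absurd e.symm hw.1
  -- If the neighbour reached is the other end of the path `w r z`, then `twin_pred` replaces `(w,
  -- r)` by `(z, r)`.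
  · by_cases hwz : w = z
    · exact hwz ▸ hrw
    · obtain rfl : u' = r := H.end_unique hw.symm hm hwz h2.right
      exact hy.tail ⟨u, u', H.twin_pred hm h2⟩

theorem reach_symm {x y : V} (h : Reach A x y) : Reach A y x := by
  induction h with
  | refl => exact .refl
  | @tail y z _ h2 ih =>
    refine ReflTransGen.trans ?_ ih
    obtain ⟨u, u', h3⟩ := h2
    rcases H.conn h3 with h1 | h1
    · exact reach_of_path h1
    · exact (reach_of_path h1).trans (H.reach_of_missing h3.left.symm)

/-- The classes of `Reach` are modules. -/
theorem arc_congr_left {x y z : V} (h : Reach A x y) (hz : ¬ Reach A x z) (hxz : A x z) :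
    A y z := by
  induction h with
  | refl => exact hxz
  | @tail y y' h1 h2 ih =>
    obtain ⟨u, u', h3⟩ := h2
    exact h3.far_fst.out ih fun hm =>
      hz ((h1.tail ⟨u, u', h3⟩).trans (H.reach_of_missing hm))

theorem arc_congr_right {x y z : V} (h : Reach A x y) (hz : ¬ Reach A x z) (hzx : A z x) :
    A z y :=
  H.reverse.arc_congr_left (reach_reverse.2 (H.reach_symm h))
    (fun h' => hz (H.reach_symm (reach_reverse.1 h'))) hzx

/-- At least one end of a missing edge in the class of `x`, but off the missing path of `x`, is an
in-neighbour of `x`. -/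
theorem arc_of_reach {x z z' : V} (h : Reach A x z) (hm : Missing A z z') (h1 : z ≠ x)
    (h2 : z' ≠ x) (h3 : ¬ Missing A z x) (h4 : ¬ Missing A z' x) : A z x ∨ A z' x := by
  induction h generalizing z' with
  | refl => exact absurd rfl h1
  | @tail y z _ hyz ih =>
    obtain ⟨y', z'', h5⟩ := hyz
    -- The chain may enter `z` with its other missing neighbour; the twin property substitutes `z'`.
    have h6 : FlagArc A (y, y') (z, z') := (H.twin_pred hm h5.swap).swap
    have left : ∀ {w}, FlagArc A (x, w) (z, z') → A z x := fun h =>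
      h.far_fst.adj h1.symm fun hm => h3 hm.symm
    have right : ∀ {w}, FlagArc A (w, x) (z, z') → A z' x := fun h =>
      h.far_snd.adj h2.symm fun hm => h4 hm.symm
    by_cases e1 : y = x
    · subst e1
      exact Or.inl (left h6)
    by_cases e2 : y' = x
    · subst e2
      exact Or.inr (right h6)
    by_cases e3 : Missing A y x
    · exact Or.inr (right (H.twin_succ e3 h6.swap).swap)
    by_cases e4 : Missing A y' x
    · exact Or.inl (left (H.twin_succ e4 h6))
    exact (ih h6.left e1 e2 e3 e4).imp (fun h => h6.far_fst.out h h3)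
      fun h => h6.far_snd.out h h4

theorem arc_to_of_reach {x z z' : V} (h : Reach A x z) (hm : Missing A z z') (h1 : z ≠ x)
    (h2 : z' ≠ x) (h3 : ¬ Missing A z x) (h4 : ¬ Missing A z' x) : A x z ∨ A x z' :=
  H.reverse.arc_of_reach (reach_reverse.2 (H.reach_symm h)) (missing_reverse.2 hm) h1 h2
    (fun h => h3 (missing_reverse.1 h)) fun h => h4 (missing_reverse.1 h)

omit H in
/-- The out-neighbours of `x` in its class. -/
def classOut (A : V → V → Prop) (x : V) : Set V :=
  {w | Reach A x w ∧ A x w}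

omit H in
/-- The second out-neighbours of `x` in its class. -/
def classSecondOut (A : V → V → Prop) (x : V) : Set V :=
  {w | Reach A x w ∧ w ≠ x ∧ ¬ A x w ∧ ∃ u, A x u ∧ A u w}

omit H in
/-- The ends of the edges to which the edge `xy` loses. -/
def succEnds (A : V → V → Prop) (x y : V) : Set V :=
  {w | ∃ w', FlagArc A (x, y) (w', w) ∨ FlagArc A (x, y) (w, w')}

omit H in
/-- The vertex `y` and its missing neighbours. -/
def pathOf (A : V → V → Prop) (y : V) : Set V :=
  insert y {z | Missing A y z}

omit H in
theorem exists_missing_of_reach {x y w : V} (hm : Missing A x y) (h : Reach A x w) :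
    ∃ w', Missing A w w' := by
  rcases h.cases_tail with rfl | ⟨u, -, u', w', h⟩
  exacts [⟨y, hm⟩, ⟨w', h.right⟩]

/-- One of the two ends of a suitable missing edge has the second neighbourhood property in its
class. -/
theorem classSNP_or [Finite V] {x y : V} (hm : Missing A x y) (hx : ∀ z, Missing A x z → z = y)
    (hy : ∀ z, Missing A y z → z ≠ x → A z x)
    (hcard : (succEnds A x y).ncard ≤ (pathOf A y).ncard) :
    (classOut A x).ncard ≤ (classSecondOut A x).ncard ∨
      (classOut A y).ncard ≤ (classSecondOut A y).ncard := by
  have hxy := H.reach_of_missing hm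
  have hyx := H.reach_symm hxy
  let K : Set V := {w | Reach A x w}
  have hfree : ∀ z, z ∉ pathOf A y → (z ≠ x ∧ ¬ Missing A z x) ∧ (z ≠ y ∧ ¬ Missing A z y) := by
    intro z hz
    have h1 : z ≠ y := fun e => hz (Or.inl e)
    have h2 : ¬ Missing A y z := fun h => hz (Or.inr h)
    exact ⟨⟨fun e => h2 (e ▸ hm.symm), fun h => h1 (hx z h.symm)⟩, h1, fun h => h2 h.symm⟩
  have hxo : ∀ z, A x z → z ∉ pathOf A y := by
    rintro z hz (rfl | h)
    · exact hm.2.1 hz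
    · by_cases e : z = x
      · subst e
        exact H.asymm _ _ hz hz
      · exact H.asymm _ _ hz (hy z h e)
  have hyo : ∀ z, A y z → z ∉ pathOf A y := by
    rintro z hz (rfl | h)
    · exact H.asymm _ _ hz hz
    · exact h.2.1 hz
  -- A common out-neighbour in the class would dominate neither `x` nor `y`, against
  -- `arc_to_of_reach`.
  have hdisj : Disjoint (classOut A x) (classOut A y) := by
    rw [Set.disjoint_left]
    rintro z ⟨h1, h2⟩ ⟨-, h3⟩
    obtain ⟨⟨h4, h5⟩, h6, h7⟩ := hfree z (hxo z h2)
    rcases H.arc_to_of_reach (H.reach_symm h1) hm h4.symm h6.symm (fun h => h5 h.symm)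
      fun h => h7 h.symm with h | h
    exacts [H.asymm _ _ h h2, H.asymm _ _ h h3]
  have hpK : pathOf A y ⊆ K := by
    rintro z (rfl | h)
    exacts [hxy, hxy.trans (H.reach_of_missing h)]
  have hout : classOut A x ∪ classOut A y ⊆ K \ pathOf A y := by
    rintro z (⟨h1, h2⟩ | ⟨h1, h2⟩)
    exacts [⟨h1, hxo z h2⟩, ⟨hxy.trans h1, hyo z h2⟩]
  have hsnd : K \ succEnds A x y ⊆ classSecondOut A x ∪ classSecondOut A y := by
    rintro w ⟨hwK, hw⟩
    obtain ⟨w', hww'⟩ := exists_missing_of_reach hm hwK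
    obtain ⟨⟨q, q'⟩, hq⟩ := H.exists_pred (p := (w', w)) hww'.symm
    have hqm : Missing A q q' := hq.left
    have hend : ∀ u v, Missing A y u → Missing A u v → v = y := by
      intro u v hu hv
      by_cases e : u = x
      · subst e
        exact hx v hv
      · exact H.end_unique hu.symm hm.symm e hv
    have hq1 : q ∉ pathOf A y := by
      rintro (rfl | h)
      · exact hw ⟨w', Or.inr (H.twin_succ hm.symm hq.swap)⟩
      · obtain rfl := hend q q' h hqm
        exact hw ⟨w', Or.inl (H.twin_succ hm.symm hq)⟩
    have hq2 : q' ∉ pathOf A y := by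
      rintro (rfl | h)
      · exact hq1 (Or.inr hqm.symm)
      · exact hq1 (Or.inl (hend q' q h hqm.symm))
    have hqK : Reach A x q := hwK.trans ((H.reach_of_missing hww').trans
      (H.reach_symm (.single ⟨q', w, hq⟩)))
    have hqw : A q w := hq.arc_fst
    -- If `t` dominates `q`, then `q'` dominates `t` by `arc_of_reach`. As `w` is far from `q'`,
    -- there is no arc from `t` to `w`, while `q` gives a two-arc path.
    have key : ∀ t, Reach A x t → q ≠ t → q' ≠ t → ¬ Missing A q t → ¬ Missing A q' t → A t q →
        w ∈ classSecondOut A t := by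
      intro t ht h1 h2 h3 h4 htq
      have htx := H.reach_symm ht
      have h5 : A q' t := (H.arc_of_reach (htx.trans hqK) hqm h1 h2 h3 h4).resolve_left
        (H.asymm _ _ htq)
      refine ⟨htx.trans hwK, ?_, hq.far_snd.2 t h5, q, htq, hqw⟩
      rintro rfl
      exact H.asymm _ _ htq hqw
    obtain ⟨⟨a1, a2⟩, a3, a4⟩ := hfree q hq1
    obtain ⟨⟨b1, b2⟩, b3, b4⟩ := hfree q' hq2
    rcases H.arc_of_reach (H.reach_symm hqK) hm a1.symm a3.symm (fun h => a2 h.symm)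
      (fun h => a4 h.symm) with h | h
    · exact Or.inl (key x .refl a1 b1 a2 b2 h)
    · exact Or.inr (key y hxy a3 b3 a4 b4 h)
  -- With `K` the class, the out-degrees sum to at most |K| − |pathOf y| ≤ |K| − |succEnds|, which
  -- the second out-degrees cover.
  have c1 := Set.ncard_le_ncard hout (Set.toFinite _)
  have c2 := Set.ncard_le_ncard hsnd (Set.toFinite _)
  rw [Set.ncard_union_eq hdisj (Set.toFinite _) (Set.toFinite _)] at c1
  have c3 := Set.ncard_union_le (classSecondOut A x) (classSecondOut A y)
  have c4 := Set.ncard_sdiff_add_ncard_of_subset hpK (Set.toFinite _)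
  have c5 := Set.le_ncard_sdiff (succEnds A x y) K (Set.toFinite _)
  omega

/-- Every missing path contains a vertex which has the second neighbourhood property in its
class. -/
theorem exists_classSNP [Finite V]
    (hcard : ∀ x y, Missing A x y → (∀ z, Missing A x z → z = y) →
      (succEnds A x y).ncard ≤ (pathOf A y).ncard) {v v' : V} (hv : Missing A v v') :
    ∃ u, ReflTransGen (Missing A) v u ∧ (classOut A u).ncard ≤ (classSecondOut A u).ncard := by
  have main : ∀ x y, Missing A x y → (∀ z, Missing A x z → z = y) →
      (∀ z, Missing A y z → z ≠ x → A z x) → ReflTransGen (Missing A) v y →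
      ∃ u, ReflTransGen (Missing A) v u ∧ (classOut A u).ncard ≤ (classSecondOut A u).ncard := by
    intro x y hm hx hy hr
    rcases H.classSNP_or hm hx hy (hcard x y hm hx) with h | h
    exacts [⟨x, hr.tail hm.symm, h⟩, ⟨y, hr, h⟩]
  have path : ∀ a b c, Missing A a b → Missing A b c → a ≠ c → ReflTransGen (Missing A) v b →
      ∃ u, ReflTransGen (Missing A) v u ∧ (classOut A u).ncard ≤ (classSecondOut A u).ncard := by
    intro a b c hab hbc hac hr
    have hm : ¬ Missing A a c := fun hm => hbc.1 (H.end_unique hab hbc hac hm).symm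
    -- The end dominated by the other end is chosen, so that it has no out-neighbour on the path.
    rcases adj_of_not_missing hac hm with h | h
    · refine main c b hbc.symm (fun z => H.end_unique hbc.symm hab.symm hac.symm) ?_ hr
      intro z hz hzc
      rw [(H.mid_unique hab hbc hac hz).resolve_right hzc]
      exact h
    · refine main a b hab (fun z => H.end_unique hab hbc hac) ?_ hr
      intro z hz hza
      rw [(H.mid_unique hab hbc hac hz).resolve_left hza]
      exact h
  by_cases h1 : ∃ c, Missing A v' c ∧ v ≠ c
  · obtain ⟨c, h2, h3⟩ := h1
    exact path v v' c hv h2 h3 (.single hv)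
  by_cases h2 : ∃ c, Missing A v c ∧ v' ≠ c
  · obtain ⟨c, h3, h4⟩ := h2
    exact path v' v c hv.symm h3 h4 .refl
  push Not at h1 h2
  exact main v v' hv (fun z hz => (h2 z hz).symm) (fun z hz hne => absurd (h1 z hz).symm hne)
    (.single hv)

/-- A class with a missing edge contains two vertices which have the second neighbourhood property
in it. -/
theorem exists_two_classSNP [Finite V]
    (hcard : ∀ x y, Missing A x y → (∀ z, Missing A x z → z = y) →
      (succEnds A x y).ncard ≤ (pathOf A y).ncard) {v v' : V} (hv : Missing A v v') :
    ∃ u₁ u₂, u₁ ≠ u₂ ∧ Reach A v u₁ ∧ Reach A v u₂ ∧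
      (classOut A u₁).ncard ≤ (classSecondOut A u₁).ncard ∧
      (classOut A u₂).ncard ≤ (classSecondOut A u₂).ncard := by
  have hr : ∀ {x y}, ReflTransGen (Missing A) x y → Reach A x y := by
    intro x y h
    induction h with
    | refl => exact .refl
    | tail _ h2 ih => exact ih.trans (H.reach_of_missing h2)
  -- A missing edge and one it loses to lie on different missing paths; each path supplies a vertex.
  obtain ⟨q, hq⟩ := H.exists_succ (p := (v, v')) hv
  obtain ⟨u₁, h1, h2⟩ := H.exists_classSNP hcard hv
  obtain ⟨u₂, h3, h4⟩ := H.exists_classSNP hcard hq.right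
  refine ⟨u₁, u₂, ?_, hr h1, ReflTransGen.trans (.single ⟨v', q.2, hq⟩) (hr h3), h2, h4⟩
  rintro rfl
  have : Std.Symm (Missing A) := ⟨fun _ _ h => h.symm⟩
  have h5 : ReflTransGen (Missing A) v q.1 := h1.trans (ReflTransGen.stdSymm.symm _ _ h3)
  have h6 : ∀ w, ReflTransGen (Missing A) v w →
      w = v ∨ Missing A v w ∨ ∃ t, Missing A v t ∧ Missing A t w ∧ v ≠ w := by
    intro w hw
    induction hw with
    | refl => exact Or.inl rfl
    | @tail w w' _ h2 ih =>
      by_cases e : w' = v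
      · exact Or.inl e
      rcases ih with rfl | h | ⟨t, h7, h8, h9⟩
      · exact Or.inr (Or.inl h2)
      · exact Or.inr (Or.inr ⟨w, h, h2, Ne.symm e⟩)
      · rw [H.end_unique h8.symm h7.symm h9.symm h2]
        exact Or.inr (Or.inl h7)
  have h7 : v' ≠ q.1 := fun e => by
    have := hq.arc_snd
    rw [← e] at this
    exact H.asymm _ _ this this
  rcases h6 _ h5 with e | h | ⟨t, h8, h9, h10⟩
  · exact hv.2.2 (e ▸ hq.arc_snd)
  · have := H.end_unique h.symm hv h7.symm hq.right
    have h11 := hq.arc_fst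
    rw [this] at h11
    exact H.asymm _ _ h11 h11
  · have := H.end_unique h8 h9 h10 hv
    exact h9.2.1 (this ▸ hq.arc_snd)

end DependencySystem

end ArcRelation

/-! ### From the dependency digraph to flags -/

namespace ArcRelation

open Relation

section

variable {V : Type*} {A : V → V → Prop}

/-- If they were not missing neighbours, transport would force arcs in both directions between `q.1`
and `q'.2`. -/
theorem FlagArc.share_succ {p q q' : V × V} (asymm : ∀ x y, A x y → ¬ A y x) (h : FlagArc A p q)
    (h' : FlagArc A p q') : Missing A q.1 q'.2 := by
  by_contra hm
  exact asymm _ _ (h.far_fst.out h'.arc_fst hm)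
    (h'.far_snd.out h.arc_snd fun h => hm h.symm)

theorem FlagArc.share_pred {p q q' : V × V} (asymm : ∀ x y, A x y → ¬ A y x) (h : FlagArc A q p)
    (h' : FlagArc A q' p) : Missing A q.1 q'.2 :=
  missing_reverse.1 (FlagArc.share_succ (fun x y => asymm y x) (flagArc_reverse.2 h)
    (flagArc_reverse.2 h'))

end

section DirectedCycle

variable {W : Type*} {H : Digraph W} {S : Set W} (h : H.IsDirectedCycleOn S)
include h

theorem cycle_exists_succ {e : W} (he : e ∈ S) : ∃ f, H.Adj e f := by
  obtain ⟨k, -, ε, -, rfl, hadj⟩ := h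
  obtain ⟨i, rfl⟩ := he
  exact ⟨ε (i + 1), (hadj _ _).2 rfl⟩

theorem cycle_exists_pred {e : W} (he : e ∈ S) : ∃ f, H.Adj f e := by
  obtain ⟨k, -, ε, -, rfl, hadj⟩ := h
  obtain ⟨i, rfl⟩ := he
  exact ⟨ε (i - 1), (hadj _ _).2 (by ring)⟩

theorem cycle_succ_unique {e f f' : W} (he : e ∈ S) (hf : f ∈ S) (hf' : f' ∈ S)
    (h1 : H.Adj e f) (h2 : H.Adj e f') : f = f' := by
  obtain ⟨k, -, ε, -, rfl, hadj⟩ := h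
  obtain ⟨i, rfl⟩ := he
  obtain ⟨j, rfl⟩ := hf
  obtain ⟨j', rfl⟩ := hf'
  rw [(hadj _ _).1 h1, (hadj _ _).1 h2]

theorem cycle_pred_unique {e f f' : W} (he : e ∈ S) (hf : f ∈ S) (hf' : f' ∈ S)
    (h1 : H.Adj f e) (h2 : H.Adj f' e) : f = f' := by
  obtain ⟨k, -, ε, -, rfl, hadj⟩ := h
  obtain ⟨i, rfl⟩ := he
  obtain ⟨j, rfl⟩ := hf
  obtain ⟨j', rfl⟩ := hf'
  rw [add_right_cancel (((hadj _ _).1 h1).symm.trans ((hadj _ _).1 h2))]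

omit h in
theorem exists_add_natCast {k : ℕ} (hk : 1 ≤ k) (i j : ZMod k) : ∃ n : ℕ, j = i + n := by
  have : NeZero k := ⟨by omega⟩
  exact ⟨(j - i).val, by simp⟩

theorem cycle_path {e f : W} (he : e ∈ S) (hf : f ∈ S) : ReflTransGen H.Adj e f := by
  obtain ⟨k, hk, ε, -, rfl, hadj⟩ := h
  obtain ⟨i, rfl⟩ := he
  obtain ⟨j, rfl⟩ := hf
  obtain ⟨n, rfl⟩ := exists_add_natCast hk i j
  induction n with
  | zero => simpa using .refl
  | succ n ih => exact ih.tail ((hadj _ _).2 (by push_cast; ring))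

end DirectedCycle

variable {V : Type*} {D : Digraph V}

theorem mem_edgeSet {x y : V} : s(x, y) ∈ D.missingGraph.edgeSet ↔ Missing D.Adj x y :=
  Iff.rfl

theorem loses_of_flagArc {p q : V × V} (h : FlagArc D.Adj p q) :
    D.Loses s(p.1, p.2) s(q.1, q.2) := by
  have hfar : ∀ {x y}, Far D.Adj x y → y ∉ D.outNbhd x ∪ D.secondOutNbhd x := by
    rintro x y hxy (h1 | ⟨-, -, u, h1, h2⟩)
    exacts [hxy.1 h1, hxy.2 u h1 h2]
  exact ⟨p.1, p.2, q.2, q.1, rfl, Sym2.eq_swap, h.arc_fst, hfar h.far_fst, h.arc_snd,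
    hfar h.far_snd⟩

theorem exists_flagArc_of_loses {x y : V} {f : Sym2 V} (hm : Missing D.Adj x y)
    (hf : f ∈ D.missingGraph.edgeSet) (h : D.Loses s(x, y) f) :
    ∃ q : V × V, f = s(q.1, q.2) ∧ FlagArc D.Adj (x, y) q := by
  obtain ⟨x', y', a, b, he, rfl, h1, h2, h3, h4⟩ := h
  have hm' : Missing D.Adj x' y' := by
    rw [← mem_edgeSet, ← he]
    exact hm
  have hfar : ∀ {x y z}, y ∉ D.outNbhd x ∪ D.secondOutNbhd x → D.Adj z y → Missing D.Adj x z →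
      Far D.Adj x y := by
    intro x y z h hzy hxz
    refine ⟨fun h' => h (Or.inl h'), fun u hu hu' => h (Or.inr ⟨?_, fun h' => h (Or.inl h'), u, hu,
      hu'⟩)⟩
    -- `secondOutNbhd` omits `x` itself while `Far` does not; the case of `x` is impossible because
    -- `z` dominates `y` and `xz` is missing.
    rintro rfl
    exact hxz.2.2 hzy
  have key : FlagArc D.Adj (x', y') (b, a) :=
    ⟨hm', Missing.symm hf, h1, hfar h2 h3 hm', h3, hfar h4 h1 hm'.symm⟩
  rcases Sym2.eq_iff.1 he with ⟨rfl, rfl⟩ | ⟨rfl, rfl⟩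
  · exact ⟨(b, a), Sym2.eq_swap, key⟩
  · exact ⟨(a, b), rfl, key.swap⟩

/-- The missing edge `xy` as a vertex of the dependency digraph. -/
def edge {x y : V} (hm : Missing D.Adj x y) : D.missingGraph.edgeSet :=
  ⟨s(x, y), hm⟩

theorem edge_symm {x y : V} (hm : Missing D.Adj x y) : edge hm.symm = edge hm :=
  Subtype.ext Sym2.eq_swap

theorem exists_eq_edge (e : D.missingGraph.edgeSet) :
    ∃ x y, ∃ hm : Missing D.Adj x y, e = edge hm := by
  obtain ⟨e, he⟩ := e
  induction e using Sym2.ind with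
  | _ x y => exact ⟨x, y, he, rfl⟩

theorem eq_or_swap_of_edge_eq {p q : V × V} {hp : Missing D.Adj p.1 p.2}
    {hq : Missing D.Adj q.1 q.2} (h : edge hp = edge hq) : p = q ∨ p = q.swap := by
  rcases Sym2.eq_iff.1 (congrArg Subtype.val h) with ⟨h1, h2⟩ | ⟨h1, h2⟩
  · exact Or.inl (Prod.ext h1 h2)
  · exact Or.inr (Prod.ext h1 h2)

theorem adj_edge {p q : V × V} (h : FlagArc D.Adj p q) :
    D.dependencyDigraph.Adj (edge h.left) (edge h.right) :=
  loses_of_flagArc h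

theorem exists_flagArc_of_adj {x y : V} (hm : Missing D.Adj x y) {f : D.missingGraph.edgeSet}
    (h : D.dependencyDigraph.Adj (edge hm) f) :
    ∃ q, ∃ h : FlagArc D.Adj (x, y) q, f = edge h.right := by
  obtain ⟨q, h1, h2⟩ := exists_flagArc_of_loses hm f.2 h
  exact ⟨q, h2, Subtype.ext h1⟩

theorem exists_path_of_path {x y : V} (hm : Missing D.Adj x y) {f : D.missingGraph.edgeSet}
    (h : ReflTransGen D.dependencyDigraph.Adj (edge hm) f) :
    ∃ q, ∃ hq : Missing D.Adj q.1 q.2, f = edge hq ∧ ReflTransGen (FlagArc D.Adj) (x, y) q := by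
  induction h with
  | refl => exact ⟨(x, y), hm, rfl, .refl⟩
  | tail _ h2 ih =>
    obtain ⟨⟨u, v⟩, hq, rfl, h3⟩ := ih
    obtain ⟨q', h4, rfl⟩ := exists_flagArc_of_adj hq h2
    exact ⟨q', h4.right, rfl, h3.tail h4⟩

/-- The component of a missing edge in the dependency digraph. -/
def comp (e : D.missingGraph.edgeSet) :
    D.dependencyDigraph.toSimpleGraphInclusive.ConnectedComponent :=
  D.dependencyDigraph.toSimpleGraphInclusive.connectedComponentMk e

theorem comp_eq_of_adj {e f : D.missingGraph.edgeSet} (h : D.dependencyDigraph.Adj e f) :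
    comp e = comp f := by
  by_cases hef : e = f
  · rw [hef]
  · refine SimpleGraph.ConnectedComponent.sound (SimpleGraph.Adj.reachable ?_)
    exact (SimpleGraph.fromRel_adj _ _ _).2 ⟨hef, Or.inl h⟩

/-- The function `p` is a missing path with two edges. -/
def IsTwoPath (D : Digraph V) (p : Fin 3 → V) : Prop :=
  Missing D.Adj (p 0) (p 1) ∧ Missing D.Adj (p 1) (p 2) ∧ p 0 ≠ p 2

theorem double_exists {S : Set D.missingGraph.edgeSet} (h : D.IsDoubleCycleOn S)
    {e : D.missingGraph.edgeSet} (he : e ∈ S) :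
    ∃ p q r : Fin 3 → V, IsTwoPath D p ∧ IsTwoPath D q ∧ IsTwoPath D r ∧
      (e : Sym2 V) ∈ Digraph.twoPathEdges p ∧
      (∀ f : D.missingGraph.edgeSet, (f : Sym2 V) ∈ Digraph.twoPathEdges p → f ∈ S) ∧
      (∀ e ∈ Digraph.twoPathEdges p, ∀ f ∈ Digraph.twoPathEdges q, D.Loses e f) ∧
      (∀ e ∈ Digraph.twoPathEdges r, ∀ f ∈ Digraph.twoPathEdges p, D.Loses e f) := by
  obtain ⟨k, -, p, hinj, hmiss, hS, hl⟩ := h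
  have hp : ∀ i, IsTwoPath D (p i) := fun i =>
    ⟨hmiss i (Or.inl rfl), hmiss i (Or.inr rfl), fun h => by
      have := @hinj (i, 0) (i, 2) h
      simp at this⟩
  obtain ⟨i, hi⟩ := (hS e).1 he
  exact ⟨p i, p (i + 1), p (i - 1), hp _, hp _, hp _, hi, fun f hf => (hS f).2 ⟨i, hf⟩, hl i,
    by simpa using hl (i - 1)⟩

theorem double_path {S : Set D.missingGraph.edgeSet} (h : D.IsDoubleCycleOn S)
    {e f : D.missingGraph.edgeSet} (he : e ∈ S) (hf : f ∈ S) :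
    ReflTransGen D.dependencyDigraph.Adj e f := by
  obtain ⟨k, hk, p, -, hmiss, hS, hl⟩ := h
  obtain ⟨i, hi⟩ := (hS e).1 he
  obtain ⟨j, hj⟩ := (hS f).1 hf
  -- At least one step is taken, so that both edges of any path are reached, including the path of
  -- `e`.
  have key : ∀ n : ℕ, ∀ g : D.missingGraph.edgeSet,
      (g : Sym2 V) ∈ Digraph.twoPathEdges (p (i + (n + 1 : ℕ))) →
      ReflTransGen D.dependencyDigraph.Adj e g := by
    intro n
    induction n with
    | zero => exact fun g hg => .single (hl i e hi g (by simpa using hg))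
    | succ n ih =>
      intro g hg
      have h1 := hmiss (i + (n + 1 : ℕ)) (Or.inl rfl)
      refine (ih ⟨_, h1⟩ (Or.inl rfl)).tail (hl _ _ (Or.inl rfl) g ?_)
      rw [add_assoc]
      exact_mod_cast hg
  obtain ⟨n, hn⟩ := exists_add_natCast hk (i + 1) j
  refine key n f ?_
  rw [show i + ((n + 1 : ℕ) : ZMod k) = j by rw [hn]; push_cast; ring]
  exact hj

section

variable (hpaths : D.MissesDisjointPaths 2)
include hpaths

theorem ncard_supp_le (c : D.missingGraph.ConnectedComponent) : c.supp.ncard ≤ 3 := by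
  obtain ⟨n, hn, ⟨φ⟩⟩ := hpaths c
  have : Nat.card c.supp = n + 1 := (Nat.card_congr φ.toEquiv).trans (Nat.card_fin _)
  rw [← Nat.card_coe_set_eq, this]
  omega

theorem not_triangle {a b c : V} (hab : Missing D.Adj a b) (hbc : Missing D.Adj b c) :
    ¬ Missing D.Adj a c := by
  intro hac
  let G := D.missingGraph
  let C := G.connectedComponentMk a
  have hb : b ∈ C.supp := SimpleGraph.ConnectedComponent.sound
    (SimpleGraph.Adj.reachable (G := G) hab.symm)
  have hc : c ∈ C.supp := SimpleGraph.ConnectedComponent.sound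
    (SimpleGraph.Adj.reachable (G := G) hac.symm)
  obtain ⟨n, hn, ⟨φ⟩⟩ := hpaths C
  have key : ∀ x y : C.supp, Missing D.Adj x y →
      (φ x).val + 1 = (φ y).val ∨ (φ y).val + 1 = (φ x).val := by
    intro x y hxy
    rw [← SimpleGraph.pathGraph_adj, φ.map_adj_iff]
    exact hxy
  have h1 := key ⟨a, rfl⟩ ⟨b, hb⟩ hab
  have h2 := key ⟨b, hb⟩ ⟨c, hc⟩ hbc
  have h3 := key ⟨a, rfl⟩ ⟨c, hc⟩ hac
  omega

theorem not_four [Finite V] {a b c d : V} (hb : Missing D.Adj a b)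
    (hc : Missing D.Adj b c) (hd : Missing D.Adj a d ∨ Missing D.Adj b d)
    (h1 : a ≠ c) (h2 : d ≠ a) (h3 : d ≠ b) (h4 : d ≠ c) : False := by
  let G := D.missingGraph
  let C := G.connectedComponentMk a
  have rb : G.Reachable b a := SimpleGraph.Adj.reachable (G := G) hb.symm
  have rc : G.Reachable c a := (SimpleGraph.Adj.reachable (G := G) hc.symm).trans rb
  have rd : G.Reachable d a := by
    rcases hd with h | h
    · exact SimpleGraph.Adj.reachable (G := G) h.symm
    · exact (SimpleGraph.Adj.reachable (G := G) h.symm).trans rb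
  have hsub : ({a, b, c, d} : Set V) ⊆ C.supp := by
    rintro x (rfl | rfl | rfl | rfl)
    exacts [rfl, SimpleGraph.ConnectedComponent.sound rb, SimpleGraph.ConnectedComponent.sound rc,
      SimpleGraph.ConnectedComponent.sound rd]
  have c1 := Set.ncard_le_ncard hsub (Set.toFinite _)
  have c2 := ncard_supp_le hpaths C
  have c3 : ({a, b, c, d} : Set V).ncard = 4 := by
    rw [Set.ncard_insert_of_notMem, Set.ncard_insert_of_notMem, Set.ncard_insert_of_notMem,
      Set.ncard_singleton]
    · simpa using h4.symm
    · simpa using ⟨hc.1, h3.symm⟩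
    · simpa using ⟨hb.1, h1, h2.symm⟩
  omega

theorem pathSystem [Finite V] (hD : D.IsOrientedGraph) : PathSystem D.Adj where
  asymm := hD
  end_unique {a b c w} hab hbc hac haw := by
    by_contra hwb
    by_cases hwc : w = c
    · subst hwc
      exact not_triangle hpaths hab hbc haw
    · exact not_four hpaths hab hbc (Or.inl haw) hac haw.1.symm hwb hwc
  mid_unique {a b c w} hab hbc hac hbw := by
    by_contra h
    push Not at h
    exact not_four hpaths hab hbc (Or.inr hbw) hac h.1 hbw.1.symm h.2

end

end ArcRelation

/-! ### The hypotheses yield a dependency system -/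

namespace ArcRelation

open Relation

variable {V : Type*} {D : Digraph V}

/-- The component of the missing edge `xy` in the dependency digraph is a directed cycle. -/
def OnCycle (D : Digraph V) (x y : V) : Prop :=
  ∃ hm : Missing D.Adj x y, D.dependencyDigraph.IsDirectedCycleOn (comp (edge hm)).supp

theorem OnCycle.of_comp_eq {p q : V × V} {hp : Missing D.Adj p.1 p.2} {hq : Missing D.Adj q.1 q.2}
    (h : comp (edge hp) = comp (edge hq)) (hc : OnCycle D p.1 p.2) : OnCycle D q.1 q.2 :=
  ⟨hq, h ▸ hc.2⟩

theorem onCycle_or_isDoubleCycleOn (h : D.ComposedOfCyclesAndDoubleCycles) {x y : V}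
    (hm : Missing D.Adj x y) : OnCycle D x y ∨ D.IsDoubleCycleOn (comp (edge hm)).supp :=
  (h _).imp (fun h => ⟨hm, h⟩) id

section

variable (hP : PathSystem D.Adj)
include hP

theorem mem_twoPathEdges_of_missing {p : Fin 3 → V} (hp : IsTwoPath D p) {x y z : V}
    (hyz : s(y, z) ∈ Digraph.twoPathEdges p) (hxy : Missing D.Adj x y) (hxz : x ≠ z) :
    s(x, y) ∈ Digraph.twoPathEdges p := by
  obtain ⟨h1, h2, h3⟩ := hp
  rcases hyz with h | h <;> rcases Sym2.eq_iff.1 h with ⟨rfl, rfl⟩ | ⟨rfl, rfl⟩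
  · exact absurd (hP.end_unique h1 h2 h3 hxy.symm) hxz
  · rw [(hP.mid_unique h1 h2 h3 hxy.symm).resolve_left hxz]
    exact Or.inr Sym2.eq_swap
  · rw [(hP.mid_unique h1 h2 h3 hxy.symm).resolve_right hxz]
    exact Or.inl rfl
  · exact absurd (hP.end_unique h2.symm h1.symm h3.symm hxy.symm) hxz

theorem mem_twoPathEdges_of_share {p : Fin 3 → V} (hp : IsTwoPath D p) {u v t t' : V}
    (huv : s(u, v) ∈ Digraph.twoPathEdges p) (hm : Missing D.Adj u v) (h1 : Missing D.Adj u t')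
    (h2 : Missing D.Adj t v) (h3 : Missing D.Adj t t') : s(t, t') ∈ Digraph.twoPathEdges p := by
  by_cases e : v = t'
  · subst e
    by_cases e' : t = u
    · rwa [e']
    · exact mem_twoPathEdges_of_missing hP hp (by rwa [Sym2.eq_swap]) h2 e'
  · obtain rfl : t = u := hP.end_unique hm.symm h1 e h2.symm
    rw [Sym2.eq_swap]
    exact mem_twoPathEdges_of_missing hP hp huv h1.symm (Ne.symm e)

omit hP in
theorem exists_third_of_mem_twoPathEdges {p : Fin 3 → V} (hp : IsTwoPath D p) {x y : V}
    (h : s(x, y) ∈ Digraph.twoPathEdges p) :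
    (∃ z, Missing D.Adj x z ∧ z ≠ y) ∨ ∃ z, Missing D.Adj y z ∧ z ≠ x := by
  obtain ⟨h1, h2, h3⟩ := hp
  rcases h with h | h <;> rcases Sym2.eq_iff.1 h with ⟨rfl, rfl⟩ | ⟨rfl, rfl⟩
  exacts [Or.inr ⟨_, h2, h3.symm⟩, Or.inl ⟨_, h2, h3.symm⟩, Or.inl ⟨_, h1.symm, h3⟩,
    Or.inr ⟨_, h1.symm, h3⟩]

variable (hcycles : D.ComposedOfCyclesAndDoubleCycles)
include hcycles

omit hP in
theorem flagArc_conn {p q : V × V} (h : FlagArc D.Adj p q) :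
    ReflTransGen (FlagArc D.Adj) q p ∨ ReflTransGen (FlagArc D.Adj) q p.swap := by
  have hc := comp_eq_of_adj (adj_edge h)
  have h1 : ReflTransGen D.dependencyDigraph.Adj (edge h.right) (edge h.left) := by
    have m1 : edge h.right ∈ (comp (edge h.right)).supp := rfl
    have m2 : edge h.left ∈ (comp (edge h.right)).supp := hc
    rcases hcycles (comp (edge h.right)) with h2 | h2
    exacts [cycle_path h2 m1 m2, double_path h2 m1 m2]
  obtain ⟨p', hp', h2, h3⟩ := exists_path_of_path _ h1
  rcases eq_or_swap_of_edge_eq h2 with e | e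
  · exact Or.inl (e ▸ h3)
  · right
    rw [e]
    simpa using h3

omit hP in
theorem flagArc_exists_succ {p : V × V} (hm : Missing D.Adj p.1 p.2) :
    ∃ q, FlagArc D.Adj p q := by
  have h1 : ∃ f, D.dependencyDigraph.Adj (edge hm) f := by
    rcases hcycles (comp (edge hm)) with h2 | h2
    · exact cycle_exists_succ h2 rfl
    · obtain ⟨p, q, r, -, hq, -, hmem, -, h3, -⟩ := double_exists h2 (e := edge hm) rfl
      exact ⟨edge hq.1, h3 _ hmem _ (Or.inl rfl)⟩
  obtain ⟨f, hf⟩ := h1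
  obtain ⟨q, hq, -⟩ := exists_flagArc_of_adj hm hf
  exact ⟨q, hq⟩

omit hP in
theorem flagArc_exists_pred {p : V × V} (hm : Missing D.Adj p.1 p.2) :
    ∃ q, FlagArc D.Adj q p := by
  have h1 : ∃ f, D.dependencyDigraph.Adj f (edge hm) := by
    rcases hcycles (comp (edge hm)) with h2 | h2
    · exact cycle_exists_pred h2 rfl
    · obtain ⟨p, q, r, -, -, hr, hmem, -, -, h3⟩ := double_exists h2 (e := edge hm) rfl
      exact ⟨edge hr.1, h3 _ (Or.inl rfl) _ hmem⟩
  obtain ⟨f, hf⟩ := h1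
  obtain ⟨x, y, hxy, rfl⟩ := exists_eq_edge f
  obtain ⟨q, hq, h2⟩ := exists_flagArc_of_adj hxy hf
  rcases eq_or_swap_of_edge_eq h2 with e | e
  · exact ⟨_, e ▸ hq⟩
  · exact ⟨(y, x), by rw [e]; exact hq.swap⟩

theorem cyclicSystem : CyclicSystem D.Adj (OnCycle D) where
  toPathSystem := hP
  symm {x y} h := OnCycle.of_comp_eq (p := (x, y)) (q := (y, x)) (hp := h.1) (hq := h.1.symm)
    (by rw [edge_symm h.1]) h
  missing h := h.1
  path {x y z} h hyz := by
    have hxy := h.1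
    by_cases hxz : x = z
    · subst hxz
      exact OnCycle.of_comp_eq (p := (x, y)) (q := (y, x)) (hp := h.1) (hq := h.1.symm)
        (by rw [edge_symm h.1]) h
    rcases onCycle_or_isDoubleCycleOn hcycles hyz with h1 | h1
    · exact h1
    · obtain ⟨p, -, -, hp, -, -, hmem, hsub, -⟩ := double_exists h1 (e := edge hyz) rfl
      have h2 := hsub (edge hxy) (mem_twoPathEdges_of_missing hP hp hmem hxy hxz)
      exact OnCycle.of_comp_eq (p := (x, y)) (q := (y, z)) (hp := hxy) (hq := hyz) h2 h
  fwd h1 h2 := OnCycle.of_comp_eq (comp_eq_of_adj (adj_edge h2)) h1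
  bwd h1 h2 := OnCycle.of_comp_eq (comp_eq_of_adj (adj_edge h2)).symm h1
  exists_succ h := flagArc_exists_succ hcycles h.1
  exists_pred h := flagArc_exists_pred hcycles h.1
  succ_unique {p q q'} h h1 h2 := by
    have e := cycle_succ_unique h.2 rfl (comp_eq_of_adj (adj_edge h1)).symm
      (comp_eq_of_adj (adj_edge h2)).symm (adj_edge h1) (adj_edge h2)
    -- The successor edge is unique; the opposite orientation would make a vertex its own missing
    -- neighbour.
    refine (eq_or_swap_of_edge_eq e).resolve_right fun e => ?_
    have := h1.share_succ hP.asymm h2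
    rw [e] at this
    exact this.1 rfl
  pred_unique {p q q'} h h1 h2 := by
    have e := cycle_pred_unique h.2 rfl (comp_eq_of_adj (adj_edge h1))
      (comp_eq_of_adj (adj_edge h2)) (adj_edge h1) (adj_edge h2)
    refine (eq_or_swap_of_edge_eq e).resolve_right fun e => ?_
    have := h1.share_pred hP.asymm h2
    rw [e] at this
    exact this.1 rfl
  conn {p q} _ h := by
    induction h with
    | refl => exact Or.inl .refl
    | tail _ h2 ih =>
      rcases flagArc_conn hcycles h2 with h3 | h3
      · exact ih.imp h3.trans h3.trans
      · rcases ih with ih | ih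
        · exact Or.inr (h3.trans (swap_path ih))
        · exact Or.inl (h3.trans (by simpa using swap_path ih))

theorem isDoubleCycleOn_of_path {a b c : V} (hab : Missing D.Adj a b) (hbc : Missing D.Adj b c)
    (hac : a ≠ c) : D.IsDoubleCycleOn (comp (edge hab)).supp :=
  (onCycle_or_isDoubleCycleOn hcycles hab).resolve_left fun h =>
    hac ((cyclicSystem hP hcycles).eq_of_missing h hbc)

theorem flagArc_twin_succ {a b c : V} {q : V × V} (hbc : Missing D.Adj b c)
    (h : FlagArc D.Adj (a, b) q) : FlagArc D.Adj (c, b) q := by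
  have hab : Missing D.Adj a b := h.left
  by_cases hac : a = c
  · rwa [← hac]
  obtain ⟨p, r, -, hp, hr, -, hmem, -, hl, -⟩ :=
    double_exists (isDoubleCycleOn_of_path hP hcycles hab hbc hac) (e := edge hab) rfl
  have hmem' : s(c, b) ∈ Digraph.twoPathEdges p :=
    mem_twoPathEdges_of_missing hP hp (z := a) (by rw [Sym2.eq_swap]; exact hmem) hbc.symm
      (Ne.symm hac)
  obtain ⟨u, hu, h1⟩ := exists_flagArc_of_loses hab (mem_edgeSet.2 hr.1) (hl _ hmem _ (Or.inl rfl))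
  -- A double cycle lists some losses but does not exclude others; two edges lost to by one flag
  -- nevertheless lie on the same missing path.
  have hq : s(q.1, q.2) ∈ Digraph.twoPathEdges r :=
    mem_twoPathEdges_of_share hP hr (u := u.1) (v := u.2) (by rw [← hu]; exact Or.inl rfl) h1.right
      (h1.share_succ hP.asymm h) (h.share_succ hP.asymm h1) h.right
  obtain ⟨w, hw, h2⟩ := exists_flagArc_of_loses hbc.symm (mem_edgeSet.2 h.right) (hl _ hmem' _ hq)
  rcases Sym2.eq_iff.1 hw with ⟨e1, e2⟩ | ⟨e1, e2⟩
  · obtain rfl : q = w := Prod.ext e1 e2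
    exact h2
  -- The opposite orientation would make `ac` a missing edge, closing a triangle.
  · obtain rfl : q = w.swap := Prod.ext e1 e2
    have : Missing D.Adj a c := h.share_pred hP.asymm h2.swap
    exact absurd (hP.end_unique hab hbc hac this).symm hbc.1

theorem flagArc_twin_pred {a b c : V} {q : V × V} (hbc : Missing D.Adj b c)
    (h : FlagArc D.Adj q (a, b)) : FlagArc D.Adj q (c, b) := by
  have hab : Missing D.Adj a b := h.right
  by_cases hac : a = c
  · rwa [← hac]
  obtain ⟨p, -, r, hp, -, hr, hmem, -, -, hl⟩ :=
    double_exists (isDoubleCycleOn_of_path hP hcycles hab hbc hac) (e := edge hab) rfl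
  have hmem' : s(c, b) ∈ Digraph.twoPathEdges p :=
    mem_twoPathEdges_of_missing hP hp (z := a) (by rw [Sym2.eq_swap]; exact hmem) hbc.symm
      (Ne.symm hac)
  obtain ⟨u, hu, h1⟩ := exists_flagArc_of_loses hr.1 (mem_edgeSet.2 hab) (hl _ (Or.inl rfl) _ hmem)
  have hq : s(q.1, q.2) ∈ Digraph.twoPathEdges r := by
    rcases Sym2.eq_iff.1 hu with ⟨e1, e2⟩ | ⟨e1, e2⟩
    · obtain rfl : u = (a, b) := Prod.ext e1.symm e2.symm
      exact mem_twoPathEdges_of_share hP hr (Or.inl rfl) hr.1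
        (h1.share_pred hP.asymm h) (h.share_pred hP.asymm h1) h.left
    · obtain rfl : u = (b, a) := Prod.ext e2.symm e1.symm
      exact mem_twoPathEdges_of_share hP hr (Or.inl Sym2.eq_swap) hr.1.symm
        (h1.swap.share_pred hP.asymm h) (h.share_pred hP.asymm h1.swap) h.left
  obtain ⟨w, hw, h2⟩ := exists_flagArc_of_loses h.left (mem_edgeSet.2 hbc.symm) (hl _ hq _ hmem')
  rcases Sym2.eq_iff.1 hw with ⟨e1, e2⟩ | ⟨e1, e2⟩
  · obtain rfl : w = (c, b) := Prod.ext e1.symm e2.symm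
    exact h2
  · obtain rfl : w = (b, c) := Prod.ext e2.symm e1.symm
    have : Missing D.Adj a c := h.share_succ hP.asymm h2
    exact absurd (hP.end_unique hab hbc hac this).symm hbc.1

theorem dependencySystem : DependencySystem D.Adj where
  toPathSystem := hP
  exists_succ := flagArc_exists_succ hcycles
  exists_pred := flagArc_exists_pred hcycles
  conn := flagArc_conn hcycles
  twin_succ := flagArc_twin_succ hP hcycles
  twin_pred := flagArc_twin_pred hP hcycles

/-- All edges to which `xy` loses lie on one missing path, of at most three vertices; this suffices
if `y` has a second missing neighbour. If not, `xy` is on a directed cycle and has a single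
successor, with two ends. -/
theorem ncard_succEnds_le [Finite V] (hpaths : D.MissesDisjointPaths 2) {x y : V}
    (hm : Missing D.Adj x y) (hx : ∀ z, Missing D.Adj x z → z = y) :
    (DependencySystem.succEnds D.Adj x y).ncard ≤ (DependencySystem.pathOf D.Adj y).ncard := by
  obtain ⟨q, hq⟩ := flagArc_exists_succ hcycles (p := (x, y)) hm
  by_cases hy : ∃ z, Missing D.Adj y z ∧ z ≠ x
  · obtain ⟨z, hz, hzx⟩ := hy
    let C := D.missingGraph.connectedComponentMk q.1
    have adj : ∀ {u v}, Missing D.Adj u v → v ∈ C.supp → u ∈ C.supp := fun h hv =>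
      (SimpleGraph.ConnectedComponent.sound
        (SimpleGraph.Adj.reachable (G := D.missingGraph) h)).trans hv
    have hsub : DependencySystem.succEnds D.Adj x y ⊆ C.supp := by
      have key : ∀ q' : V × V, FlagArc D.Adj (x, y) q' → q'.1 ∈ C.supp ∧ q'.2 ∈ C.supp := by
        intro q' hq'
        have h2 : q'.2 ∈ C.supp := adj (hq.share_succ hP.asymm hq').symm rfl
        exact ⟨adj hq'.right h2, h2⟩
      rintro w ⟨w', h | h⟩
      exacts [(key _ h).2, (key _ h).1]
    have hsub' : ({x, y, z} : Set V) ⊆ DependencySystem.pathOf D.Adj y := by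
      rintro w (rfl | rfl | rfl)
      exacts [Or.inr hm.symm, Or.inl rfl, Or.inr hz]
    have c1 := Set.ncard_le_ncard hsub (Set.toFinite _)
    have c2 := Set.ncard_le_ncard hsub' (Set.toFinite _)
    have c3 := ncard_supp_le hpaths C
    rw [Set.ncard_eq_three.2 ⟨x, y, z, hm.1, hzx.symm, hz.1, rfl⟩] at c2
    omega
  · push Not at hy
    have hc : OnCycle D x y := by
      refine (onCycle_or_isDoubleCycleOn hcycles hm).resolve_right fun h => ?_
      obtain ⟨p, -, -, hp, -, -, hmem, -⟩ := double_exists h (e := edge hm) rfl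
      rcases exists_third_of_mem_twoPathEdges hp hmem with ⟨z, h1, h2⟩ | ⟨z, h1, h2⟩
      exacts [h2 (hx z h1), h2 (hy z h1)]
    have hsub : DependencySystem.succEnds D.Adj x y ⊆ {q.1, q.2} := by
      rintro w ⟨w', h | h⟩
      · rw [(cyclicSystem hP hcycles).succ_unique (p := (x, y)) hc hq h]
        exact Or.inr rfl
      · rw [(cyclicSystem hP hcycles).succ_unique (p := (x, y)) hc hq h]
        exact Or.inl rfl
    have hsub' : ({x, y} : Set V) ⊆ DependencySystem.pathOf D.Adj y := by
      rintro w (rfl | rfl)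
      exacts [Or.inr hm.symm, Or.inl rfl]
    have c1 := Set.ncard_le_ncard hsub (Set.toFinite _)
    have c2 := Set.ncard_le_ncard hsub' (Set.toFinite _)
    rw [Set.ncard_pair hm.1] at c2
    have c3 := Set.ncard_insert_le q.1 {q.2}
    rw [Set.ncard_singleton] at c3
    omega

end

end ArcRelation

/-! ### The weighted quotient tournament -/

namespace ArcRelation

open Relation DependencySystem MedianOrder

variable {V : Type*} {A : V → V → Prop} (H : DependencySystem A)
include H

/-- The classes of `Reach`. -/
def classSetoid : Setoid V :=
  ⟨Reach A, fun _ => .refl, fun h => H.reach_symm h, fun h h' => ReflTransGen.trans h h'⟩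

/-- The arcs between different classes of `Reach`. -/
def classArc (a b : Quotient (classSetoid H)) : Prop :=
  a ≠ b ∧ ∃ x y, ⟦x⟧ = a ∧ ⟦y⟧ = b ∧ A x y

/-- The number of vertices in a class. -/
noncomputable def classWeight (a : Quotient (classSetoid H)) : ℕ :=
  {v : V | (⟦v⟧ : Quotient (classSetoid H)) = a}.ncard

theorem class_eq_iff {x y : V} :
    (⟦x⟧ : Quotient (classSetoid H)) = ⟦y⟧ ↔ Reach A x y :=
  Quotient.eq (r := classSetoid H)

/-- Classes are modules, so any representatives witness an arc between them. -/
theorem classArc_iff {x y : V} :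
    classArc H ⟦x⟧ ⟦y⟧ ↔ ¬ Reach A x y ∧ A x y := by
  constructor
  · rintro ⟨hne, x', y', hx, hy, h⟩
    rw [ne_eq, class_eq_iff] at hne
    rw [class_eq_iff] at hx hy
    refine ⟨hne, ?_⟩
    have h1 : ¬ Reach A x' y' := fun h' => hne ((H.reach_symm hx).trans (h'.trans hy))
    have h2 : A x y' := H.arc_congr_left hx h1 h
    exact H.arc_congr_right hy (fun h' => hne ((H.reach_symm h').trans hy)) h2
  · rintro ⟨h1, h2⟩
    exact ⟨by rwa [ne_eq, class_eq_iff], x, y, rfl, rfl, h2⟩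

theorem classArc_asymm (a b : Quotient (classSetoid H)) (h : classArc H a b) :
    ¬ classArc H b a := by
  induction a using Quotient.inductionOn with | _ x => ?_
  induction b using Quotient.inductionOn with | _ y => ?_
  rw [classArc_iff] at h ⊢
  exact fun h' => H.asymm _ _ h.2 h'.2

theorem classArc_total (a b : Quotient (classSetoid H)) (hab : a ≠ b) :
    classArc H a b ∨ classArc H b a := by
  induction a using Quotient.inductionOn with | _ x => ?_
  induction b using Quotient.inductionOn with | _ y => ?_
  rw [ne_eq, class_eq_iff] at hab
  rw [classArc_iff, classArc_iff]
  have hxy : x ≠ y := by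
    rintro rfl
    exact hab .refl
  exact (adj_of_not_missing hxy fun h => hab (H.reach_of_missing h)).imp (fun h => ⟨hab, h⟩)
    fun h => ⟨fun h' => hab (H.reach_symm h'), h⟩

theorem classWeight_pos [Finite V] (a : Quotient (classSetoid H)) : 0 < classWeight H a := by
  induction a using Quotient.inductionOn with | _ x => ?_
  exact (Set.ncard_pos (Set.toFinite _)).2 ⟨x, rfl⟩

theorem sum_classWeight [Finite V] (S : Finset (Quotient (classSetoid H))) :
    ∑ a ∈ S, classWeight H a = {v : V | (⟦v⟧ : Quotient (classSetoid H)) ∈ S}.ncard := by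
  classical
  have := Fintype.ofFinite V
  rw [Set.ncard_eq_toFinset_card', Finset.card_eq_sum_card_fiberwise (t := S)
    (f := fun v => (⟦v⟧ : Quotient (classSetoid H))) (fun v hv => by simpa using hv)]
  refine Finset.sum_congr rfl fun a ha => ?_
  rw [classWeight, Set.ncard_eq_toFinset_card']
  congr 1
  ext v
  simp only [Set.mem_toFinset, Set.mem_ofPred_eq, Finset.mem_filter]
  exact ⟨fun h => ⟨h ▸ ha, h⟩, fun h => h.2⟩

omit H in
theorem hasSNP_of_class [Finite V] {D : Digraph V} (H : DependencySystem D.Adj) {x : V}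
    (h1 : (classOut D.Adj x).ncard ≤ (classSecondOut D.Adj x).ncard)
    (h2 : HasWeightedSNP (classArc H) (classWeight H) ⟦x⟧) : D.HasSNP x := by
  classical
  have := Fintype.ofFinite (Quotient (classSetoid H))
  let S : Finset (Quotient (classSetoid H)) := Finset.univ.filter fun a => classArc H ⟦x⟧ a
  let T : Finset (Quotient (classSetoid H)) := Finset.univ.filter fun a =>
    a ≠ ⟦x⟧ ∧ ¬ classArc H ⟦x⟧ a ∧ ∃ b, classArc H ⟦x⟧ b ∧ classArc H b a
  have h3 := h2 S T (by simp [S]) (by simp [T])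
  rw [sum_classWeight, sum_classWeight] at h3
  -- Neighbourhoods split into the part inside the class and whole classes outside, whose sizes are
  -- the weights.
  have hout : D.outNbhd x ⊆
      classOut D.Adj x ∪ {v : V | (⟦v⟧ : Quotient (classSetoid H)) ∈ S} := by
    intro y hy
    by_cases h : Reach D.Adj x y
    · exact Or.inl ⟨h, hy⟩
    · right
      simpa [S, classArc_iff] using ⟨h, hy⟩
  have hsnd : classSecondOut D.Adj x ∪ {v : V | (⟦v⟧ : Quotient (classSetoid H)) ∈ T} ⊆
      D.secondOutNbhd x := by
    rintro y (⟨-, hy⟩ | hy)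
    · exact hy
    · simp only [T, Finset.mem_filter, Finset.mem_univ, true_and, Set.mem_ofPred_eq] at hy
      obtain ⟨hne, hn, b, hb, hb'⟩ := hy
      induction b using Quotient.inductionOn with | _ u => ?_
      rw [classArc_iff] at hb hb' hn
      refine ⟨fun e => hne (by rw [e]), fun hxy => hn ⟨fun h => hne ?_, hxy⟩, u, hb.2, hb'.2⟩
      exact ((class_eq_iff H).2 h).symm
  have hdisj : Disjoint (classSecondOut D.Adj x)
      {v : V | (⟦v⟧ : Quotient (classSetoid H)) ∈ T} := by
    rw [Set.disjoint_left]
    rintro y ⟨hy, -⟩ hy'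
    simp only [T, Finset.mem_filter, Finset.mem_univ, true_and, Set.mem_ofPred_eq] at hy'
    exact hy'.1 ((class_eq_iff H).2 hy).symm
  have c1 := Set.ncard_le_ncard hout (Set.toFinite _)
  have c2 := Set.ncard_le_ncard hsnd (Set.toFinite _)
  have c3 := Set.ncard_union_le (classOut D.Adj x)
    {v : V | (⟦v⟧ : Quotient (classSetoid H)) ∈ S}
  rw [Set.ncard_union_eq hdisj (Set.toFinite _) (Set.toFinite _)] at c2
  unfold Digraph.HasSNP
  omega

omit H in
theorem eq_of_reach_of_not_missing {x y : V} (hx : ∀ z, ¬ Missing A x z) (h : Reach A x y) :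
    x = y := by
  rcases h.cases_head with e | ⟨u, ⟨x', y', h'⟩, -⟩
  exacts [e, absurd h'.left (hx _)]

omit H in
theorem classOut_eq_empty (asymm : ∀ x y, A x y → ¬ A y x) {x : V} (hx : ∀ z, ¬ Missing A x z) :
    classOut A x = ∅ := by
  ext y
  simp only [classOut, Set.mem_ofPred_eq, Set.mem_empty_iff_false, iff_false, not_and]
  intro h h'
  obtain rfl := eq_of_reach_of_not_missing hx h
  exact asymm _ _ h' h'

end ArcRelation

/-! ### Two vertices from the end of a median order -/

open ArcRelation MedianOrder DependencySystem in
theorem mainTheorem4 {V : Type*} [Finite V] [Nonempty V] (D : Digraph V)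
    (hD : D.IsOrientedGraph)
    (hpaths : D.MissesDisjointPaths 2)
    (hcycles : D.ComposedOfCyclesAndDoubleCycles)
    (hsink : ∀ v, ¬ D.IsSink v) :
    ∃ u v : V, u ≠ v ∧ D.HasSNP u ∧ D.HasSNP v := by
  classical
  have hP := pathSystem hpaths hD
  have H := dependencySystem hP hcycles
  have hcard : ∀ x y, Missing D.Adj x y → (∀ z, Missing D.Adj x z → z = y) →
      (succEnds D.Adj x y).ncard ≤ (pathOf D.Adj y).ncard :=
    fun x y => ncard_succEnds_le hP hcycles hpaths
  have := Fintype.ofFinite (Quotient (classSetoid H))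
  obtain ⟨l', hl', hm⟩ := exists_isMedian (r := classArc H) (w := classWeight H)
    (Finset.univ : Finset (Quotient (classSetoid H))).toList
  have hnd : l'.Nodup := hl'.nodup_iff.2 (Finset.nodup_toList _)
  have hall : ∀ q, q ∈ l' := fun q => hl'.symm.subset (by simp)
  obtain ⟨l, f, rfl⟩ : ∃ l f, l' = l ++ [f] := by
    rcases List.eq_nil_or_concat l' with rfl | ⟨l, f, h⟩
    · obtain ⟨v⟩ := ‹Nonempty V›
      exact absurd (hall ⟦v⟧) (by simp)
    · exact ⟨l, f, by simpa using h⟩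
  have hf := hm.hasWeightedSNP (classWeight_pos H) (classArc_asymm H) (classArc_total H) hnd hall
  obtain ⟨x, rfl⟩ := Quotient.exists_rep f
  have transfer : ∀ {x u}, HasWeightedSNP (classArc H) (classWeight H) ⟦x⟧ → Reach D.Adj x u →
      (classOut D.Adj u).ncard ≤ (classSecondOut D.Adj u).ncard → D.HasSNP u := by
    intro x u h1 h2 h3
    rw [(class_eq_iff H).2 h2] at h1
    exact hasSNP_of_class H h3 h1
  have single : ∀ {x}, (∀ z, ¬ Missing D.Adj x z) →
      HasWeightedSNP (classArc H) (classWeight H) ⟦x⟧ → D.HasSNP x := by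
    intro x hx h
    refine transfer h .refl ?_
    rw [classOut_eq_empty hD hx]
    simp
  by_cases hx : ∃ z, Missing D.Adj x z
  · obtain ⟨z, hz⟩ := hx
    obtain ⟨u₁, u₂, hne, h1, h2, h3, h4⟩ := H.exists_two_classSNP hcard hz
    exact ⟨u₁, u₂, hne, transfer hf h1 h3, transfer hf h2 h4⟩
  push Not at hx
  obtain ⟨y, hy⟩ : (D.outNbhd x).Nonempty := Set.nonempty_iff_ne_empty.2 (hsink x)
  have hxy : classArc H ⟦x⟧ ⟦y⟧ := by
    refine (classArc_iff H).2 ⟨fun h => ?_, hy⟩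
    obtain rfl := eq_of_reach_of_not_missing hx h
    exact hD _ _ hy hy
  have hw : classWeight H ⟦x⟧ = 1 := by
    rw [classWeight, Set.ncard_eq_one]
    refine ⟨x, Set.ext fun v => ⟨fun h => ?_, fun h => by rw [h]; rfl⟩⟩
    exact (eq_of_reach_of_not_missing hx ((class_eq_iff H).1 h.symm)).symm
  obtain ⟨g, hgf, hg⟩ := hm.exists_second (classWeight_pos H) (classArc_asymm H)
    (classArc_total H) hnd hall hw hxy
  obtain ⟨v, rfl⟩ := Quotient.exists_rep g
  have hxv : ∀ u, Reach D.Adj v u → x ≠ u := by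
    rintro u h rfl
    exact hgf ((class_eq_iff H).2 h)
  by_cases hv : ∃ z, Missing D.Adj v z
  · obtain ⟨z, hz⟩ := hv
    obtain ⟨u, -, -, h1, -, h3, -⟩ := H.exists_two_classSNP hcard hz
    exact ⟨x, u, hxv u h1, single hx hf, transfer hg h1 h3⟩
  · push Not at hv
    exact ⟨x, v, hxv v .refl, single hx hf, single hv hg⟩
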